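/- Let $(X,d)$ be a non-empty metric space with bounded geometry, i.e. for every $R$ the number $\sup_{x\in X}\sharp B(x,R)$ is finite, where $B(x,R)$ is the closed ball. Write $C_b(X)$ for the bounded continuous functions $X\to\mathbb C$, acting on $\ell^2(X)=\ell^2(X;\mathbb C)$ by pointwise multiplication, and $\mathrm{supp}$ for the closed support. For sets, $d(A,B)=\inf_{a\in A,b\in B}d(a,b)$ (equal to $\infty$ if $A$ or $B$ is empty). For $L,\varepsilon>0$ let $\mathrm{Commut}(L,\varepsilon)$ be the set of all $a\in\mathfrak B(\ell^2(X))$ with $\|[a,f]\|<\varepsilon$ for every $L$-Lipschitz $f\in C_b(X)$ with $\|f\|_\infty\le 1$. An operator $a\in\mathfrak B(\ell^2(X))$ has propagation at most $R$ if $faf'=0$ for all $f,f'\in C_b(X)$ with $d(\mathrm{supp} f,\mathrm{supp} f')>R$. Let $p\in[1,\infty)$. Then the following are equivalent: 1. $X$ has Property A: for all $r,\varepsilon>0$ there is a family $\{\phi_i:X\to[0,1]\}_{i\in I}$ such that $\{\mathrm{supp}(\phi_i)\}_{i\in I}$ is uniformly bounded in diameter and has finite multiplicity (there is $N\in\mathbb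 N$ such that every point of $X$ lies in at most $N$ of these supports), $\sum_{i\in I}\phi_i(x)^p=1$ for all $x\in X$, and $\sum_{i\in I}|\phi_i(x)-\phi_i(y)|^p<\varepsilon^p$ for all $x,y\in X$ with $d(x,y)\le r$. 2. $X$ has the metric sparsification property: for every $c\in(0,1)$ there is a non-decreasing function $f:\mathbb N\to\mathbb N$ such that for every $m\in\mathbb N$ and every finite positive Borel measure $\mu$ on $X$ there is a Borel set $\Omega=\bigsqcup_{i\in I}\Omega_i\subseteq X$ with $d(\Omega_i,\Omega_j)\ge m$ for all $i\ne j$, $\mathrm{diam}(\Omega_i)\le f(m)$ for all $i\in I$, and $\mu(\Omega)\ge c\,\mu(X)$. 3. For all $\varepsilon>0$, $L>0$ and $M>0$ there is $s>0$ such that for every $b\in\mathfrak B(\ell^2(X))$ with $\|b\|\le M$ and $b\in\mathrm{Commut}(L,\frac{\varepsilon}{6})$ there is a unit vector $v\in\ell^2(X)$ with $\mathrm{diam}(\mathrm{supp}\,v)\le s$ and $\|bv\|\ge\|b\|-\varepsilon$. 4. For all $c\in(0,1)$ and $L>0$ there is $s>0$ such that for every $b\in\mathfrak B(\ell^2(X))$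 with $\|b\|=1$ and $b\in\mathrm{Commut}(L,\frac{1-c}{6})$ there is a unit vector $v\in\ell^2(X)$ with $\mathrm{diam}(\mathrm{supp}\,v)\le s$ and $\|bv\|\ge c$. 5. $X$ has the operator norm localisation property: for all $c\in(0,1)$ and $R>0$ there is $S>0$ such that for every $a\in\mathfrak B(\ell^2(X))$ with propagation at most $R$ and $\|a\|=1$ there is a unit vector $v\in\ell^2(X)$ with $\mathrm{diam}(\mathrm{supp}\,v)\le S$ and $\|av\|\ge c$. -/

import Mathlib

open MeasureTheory
open scoped ENNReal NNReal BoundedContinuousFunction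

universe u

/-- A metric space has bounded geometry if, for every `R`, the closed balls of radius `R` have
uniformly bounded finite cardinality. -/
def BoundedGeometry (X : Type u) [MetricSpace X] : Prop :=
  ∀ R : ℝ, ∃ N : ℕ, ∀ x : X, (Metric.closedBall x R).encard ≤ N

/-- The distance `inf {d(a,b) : a ∈ A, b ∈ B}` between two sets, with value `∞` if one of them
is empty. -/
noncomputable def setEDist {X : Type u} [MetricSpace X] (A B : Set X) : ℝ≥0∞ :=
  ⨅ (a ∈ A) (b ∈ B), edist a b

/-- A metric `p`-partition of unity: a family of functions `φ i : X → [0,1]` whose (closed)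
supports are uniformly bounded and have finite multiplicity, with `∑ i, φ i x ^ p = 1` for
every `x`. -/
structure IsMetricPartitionOfUnity (p : ℝ) {X : Type u} [MetricSpace X] {ι : Type u}
    (φ : ι → X → ℝ) : Prop where
  mem_unitInterval : ∀ i x, φ i x ∈ Set.Icc (0 : ℝ) 1
  uniformly_bounded : ∃ D : ℝ≥0, ∀ i, Metric.ediam (tsupport (φ i)) ≤ D
  finite_multiplicity : ∃ M : ℕ, ∀ x, {i | x ∈ tsupport (φ i)}.encard ≤ M
  hasSum_one : ∀ x, HasSum (fun i => φ i x ^ p) 1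

/-- The family `φ` has `(r, ε)`-variation. For a metric partition of unity the sum has only
finitely many nonzero terms. -/
def HasVariation (p : ℝ) {X : Type u} [MetricSpace X] {ι : Type u}
    (φ : ι → X → ℝ) (r ε : ℝ) : Prop :=
  ∀ x y : X, dist x y ≤ r → ∑' i, |φ i x - φ i y| ^ p < ε ^ p

/-- Property A, formulated with metric `p`-partitions of unity, `p ∈ [1, ∞)`. Since the supports
have finite multiplicity, only at most `ℵ₀ * #X` indices carry a nonzero function, so that index
types in the universe of `X` suffice. -/
def PropertyA (p : ℝ) (X : Type u) [MetricSpace X] : Prop :=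
  ∀ r ε : ℝ, 0 < r → 0 < ε →
    ∃ (ι : Type u) (φ : ι → X → ℝ), IsMetricPartitionOfUnity p φ ∧ HasVariation p φ r ε

/-- The metric sparsification property. The measurable structure is meant to be the Borel one;
the pieces `Ω i` are disjoint and `⋃ i, Ω i` is the Borel set carrying most of the mass. -/
def MetricSparsification (X : Type u) [MetricSpace X] [MeasurableSpace X] : Prop :=
  ∀ c : ℝ, 0 < c → c < 1 → ∃ f : ℕ → ℕ, Monotone f ∧
    ∀ (m : ℕ) (μ : Measure X) [IsFiniteMeasure μ], ∃ (ι : Type u) (Ω : ι → Set X),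
      MeasurableSet (⋃ i, Ω i) ∧
      (∀ i j, i ≠ j → Disjoint (Ω i) (Ω j)) ∧
      (∀ i j, i ≠ j → (m : ℝ≥0∞) ≤ setEDist (Ω i) (Ω j)) ∧
      (∀ i, Metric.ediam (Ω i) ≤ (f m : ℝ≥0∞)) ∧
      c * μ.real Set.univ ≤ μ.real (⋃ i, Ω i)

/-- The Hilbert space `ℓ²(X)` of square-summable complex functions on `X`. -/
abbrev Ell2 (X : Type u) : Type u := lp (fun _ : X => ℂ) 2

/-- Pointwise multiplication by a bounded continuous function, as an operator on `ℓ²(X)`. -/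
noncomputable def multOp {X : Type u} [MetricSpace X] (f : X →ᵇ ℂ) : Ell2 X →L[ℂ] Ell2 X :=
  lp.mapCLM 2 (fun x => f x • ContinuousLinearMap.id ℂ ℂ) (norm_nonneg f)
    (fun x => by simpa [norm_smul] using f.norm_coe_le_norm x)

theorem multOp_apply {X : Type u} [MetricSpace X] (f : X →ᵇ ℂ) (v : Ell2 X) (x : X) :
    multOp f v x = f x * v x := by
  simp [multOp]

/-- `Commut(L, ε)`: the operators `a` on `ℓ²(X)` with `‖[a, f]‖ < ε` for every `L`-Lipschitz
function `f` in the closed unit ball of `C_b(X)`. -/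
def Commut (X : Type u) [MetricSpace X] (L : ℝ≥0) (ε : ℝ) : Set (Ell2 X →L[ℂ] Ell2 X) :=
  {a | ∀ f : X →ᵇ ℂ, ‖f‖ ≤ 1 → LipschitzWith L f →
    ‖a ∘L multOp f - multOp f ∘L a‖ < ε}

/-- `a` has propagation at most `R`: `f a f' = 0` whenever the supports of `f, f' ∈ C_b(X)` are at
distance greater than `R`. -/
def PropagationAtMost {X : Type u} [MetricSpace X] (a : Ell2 X →L[ℂ] Ell2 X) (R : ℝ) : Prop :=
  ∀ f f' : X →ᵇ ℂ, ENNReal.ofReal R < setEDist (tsupport f) (tsupport f') →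
    multOp f ∘L a ∘L multOp f' = 0

/-- `v` is a unit vector of `ℓ²(X)` whose support has diameter at most `s`. -/
def IsUnitSupportedIn {X : Type u} [MetricSpace X] (v : Ell2 X) (s : ℝ) : Prop :=
  ‖v‖ = 1 ∧ Metric.ediam (tsupport (v : X → ℂ)) ≤ ENNReal.ofReal s

/-- Norm localisation for operators almost commuting with Lipschitz functions, `ε`-form. -/
def CommutantLocalisationEps (X : Type u) [MetricSpace X] : Prop :=
  ∀ (ε : ℝ) (L : ℝ≥0) (M : ℝ), 0 < ε → 0 < L → 0 < M → ∃ s : ℝ, 0 < s ∧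
    ∀ b : Ell2 X →L[ℂ] Ell2 X, ‖b‖ ≤ M → b ∈ Commut X L (ε / 6) →
      ∃ v : Ell2 X, IsUnitSupportedIn v s ∧ ‖b‖ - ε ≤ ‖b v‖

/-- Norm localisation for operators almost commuting with Lipschitz functions, `c`-form. -/
def CommutantLocalisationC (X : Type u) [MetricSpace X] : Prop :=
  ∀ (c : ℝ) (L : ℝ≥0), 0 < c → c < 1 → 0 < L → ∃ s : ℝ, 0 < s ∧
    ∀ b : Ell2 X →L[ℂ] Ell2 X, ‖b‖ = 1 → b ∈ Commut X L ((1 - c) / 6) →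
      ∃ v : Ell2 X, IsUnitSupportedIn v s ∧ c ≤ ‖b v‖

/-- The operator norm localisation property. -/
def OperatorNormLocalisation (X : Type u) [MetricSpace X] : Prop :=
  ∀ c R : ℝ, 0 < c → c < 1 → 0 < R → ∃ S : ℝ, 0 < S ∧
    ∀ a : Ell2 X →L[ℂ] Ell2 X, PropagationAtMost a R → ‖a‖ = 1 →
      ∃ v : Ell2 X, IsUnitSupportedIn v S ∧ c ≤ ‖a v‖

/-!
The five properties are proved equivalent in a cycle. In a space of bounded geometry balls are
finite, so `X` is discrete: every function is continuous, and supports are closed.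

*Property A implies sparsification.* After passing from `φ i` to `φ i ^ p`, the members of a slowly
varying partition of unity have level sets `{x | t < φ i x ^ p}` of bounded diameter. Integrating
over `t` and summing over `i` shows that, for any given mass distribution on a finite set, one of
them has a boundary of small relative mass (`exists_level_set_of_partition`). Cutting it out
together with its boundary, and repeating, leaves well separated pieces carrying most of the mass
(`exists_separated_of_small_boundary`).

*Sparsification implies localisation for operators almost commuting with Lipschitz functions.* Let
`v` almost attain the norm of `b`, and let `v'` be its restriction to a set `⋃ i, Ω i`, sparse for
the measure `|v|²`. For signs `σ i` there is an `L`-Lipschitz `h` in the unit ball with `h = σ i` on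
`Ω i`, so that `b v' = b h (h v')` is within `‖[b, h]‖` of `h b (h v')`. For suitable signs the norm
of `b (h v')` is at most what it would be if the images of the pieces `v|Ω i` were orthogonal
(`exists_signs_norm_sum_sq_le`), so `b` almost attains its norm on one of these pieces.

*Localisation for these operators implies operator norm localisation.* Operators of finite
propagation are among them for small `L`, by Schur's test (`Ell2.norm_commutator_le`).

*Operator norm localisation implies Property A.* The kernels `w` on `X` with rows of mass at most
one, supported in balls of a fixed radius, form a convex set, and the affinity
`∑ z, √(w x z * w y z)` of two rows is concave. By the minimax principle
(`exists_mem_forall_pos_of_convex`), kernels with affinities close to one at neighbouring points of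
a finite set exist unless some nonnegative weights `α x` on points and `a x y` on pairs of
neighbours obstruct. A local vector on which the form of `a` exceeds that of `α` removes the
obstruction. If there is none, the matrix `a x y / √(α x * α y)` is locally bounded by one, hence almost bounded by one by
norm localisation, and testing it on the vector `√α` gives `∑ a ≤ (1 + small) * ∑ α`
(`mul_sum_le_sum_of_nonneg`), so that the zero kernel removes it. A compactness argument passes from
finite subsets to `X`, and the `p`-th roots of the resulting kernel form the partition of unity.
-/

/-! ### Spaces of bounded geometry -/

namespace BoundedGeometry

variable {X : Type u} [MetricSpace X]

theorem finite_closedBall (hX : BoundedGeometry X) (x : X) (R : ℝ) :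
    (Metric.closedBall x R).Finite := by
  obtain ⟨N, hN⟩ := hX R
  exact Set.finite_of_encard_le_coe (hN x)

theorem discreteTopology (hX : BoundedGeometry X) : DiscreteTopology X := by
  rw [discreteTopology_iff_isOpen_singleton]
  intro x
  have hfin : (Metric.closedBall x 1 \ {x}).Finite := (hX.finite_closedBall x 1).sdiff
  have : ({x} : Set X) = Metric.ball x 1 ∩ (Metric.closedBall x 1 \ {x})ᶜ := by
    ext y
    simp only [Set.mem_singleton_iff, Set.mem_inter_iff, Metric.mem_ball, Set.mem_compl_iff,
      Set.mem_sdiff, Metric.mem_closedBall, not_and, not_not]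
    constructor
    · rintro rfl
      simp
    · rintro ⟨h1, h2⟩
      exact h2 h1.le
  rw [this]
  exact Metric.isOpen_ball.inter hfin.isClosed.isOpen_compl

/-- The closed ball of radius `R` around `x`, as a finite set. -/
noncomputable def ballFinset (hX : BoundedGeometry X) (x : X) (R : ℝ) : Finset X :=
  (hX.finite_closedBall x R).toFinset

@[simp]
theorem mem_ballFinset (hX : BoundedGeometry X) {x y : X} {R : ℝ} :
    y ∈ hX.ballFinset x R ↔ dist y x ≤ R := by
  simp [ballFinset]

theorem exists_card_ballFinset_le (hX : BoundedGeometry X) (R : ℝ) :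
    ∃ N : ℕ, ∀ x, (hX.ballFinset x R).card ≤ N := by
  obtain ⟨N, hN⟩ := hX R
  refine ⟨N, fun x => ?_⟩
  have h := hN x
  rw [(hX.finite_closedBall x R).encard_eq_coe_toFinset_card] at h
  exact_mod_cast h

end BoundedGeometry

theorem tsupport_eq_support_of_discrete {X E : Type*} [TopologicalSpace X] [DiscreteTopology X]
    [Zero E] (f : X → E) : tsupport f = Function.support f :=
  (isClosed_discrete _).closure_eq

/-! ### The Hilbert space of square-summable functions -/

namespace Ell2

variable {X : Type u}

theorem sum_norm_sq_le (v : Ell2 X) (s : Finset X) : ∑ x ∈ s, ‖v x‖ ^ 2 ≤ ‖v‖ ^ 2 := by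
  have := lp.sum_rpow_le_norm_rpow (p := 2) (by simp) v s
  simpa using this

theorem norm_le_of_sum_norm_sq_le {v : Ell2 X} {C : ℝ} (hC : 0 ≤ C)
    (h : ∀ s : Finset X, ∑ x ∈ s, ‖v x‖ ^ 2 ≤ C ^ 2) : ‖v‖ ≤ C :=
  lp.norm_le_of_forall_sum_le (p := 2) (by simp) hC (by simpa using h)

theorem norm_sq_eq_sum {v : Ell2 X} {s : Finset X} (h : ∀ x ∉ s, v x = 0) :
    ‖v‖ ^ 2 = ∑ x ∈ s, ‖v x‖ ^ 2 := by
  have := lp.norm_rpow_eq_tsum (p := 2) (by simp) v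
  rw [tsum_eq_sum (s := s) (fun x hx => by simp [h x hx])] at this
  simpa using this

/-- Finitely supported vectors suffice to approximate an operator norm. -/
theorem exists_finite_support_lt_norm_apply {b : Ell2 X →L[ℂ] Ell2 X} {t : ℝ} (ht0 : 0 ≤ t)
    (ht : t < ‖b‖) : ∃ (v : Ell2 X) (s : Finset X), (∀ x ∉ s, v x = 0) ∧ t * ‖v‖ < ‖b v‖ := by
  classical
  obtain ⟨v, hv1, hv⟩ := b.exists_lt_apply_of_lt_opNorm ht
  have hlt : t * ‖v‖ < ‖b v‖ := (mul_le_of_le_one_right ht0 hv1.le).trans_lt hv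
  have hsum := lp.hasSum_single (p := 2) (by simp) v
  have hopen : IsOpen {w : Ell2 X | t * ‖w‖ < ‖b w‖} :=
    isOpen_lt (by fun_prop) (by fun_prop)
  obtain ⟨s, hs⟩ := (hsum.eventually (hopen.mem_nhds hlt)).exists
  refine ⟨_, s, fun x hx => ?_, hs⟩
  rw [lp.coeFn_sum, Finset.sum_apply]
  refine Finset.sum_eq_zero fun y hy => lp.single_apply_ne _ _ _ ?_
  rintro rfl
  exact hx hy

end Ell2

theorem isUnitSupportedIn_single {X : Type u} [MetricSpace X] [DiscreteTopology X] [DecidableEq X]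
    (x : X) (s : ℝ) : IsUnitSupportedIn (lp.single 2 x (1 : ℂ)) s := by
  refine ⟨by rw [lp.norm_single (by simp)]; simp, ?_⟩
  rw [tsupport_eq_support_of_discrete, Metric.ediam_subsingleton]
  · simp
  · intro y hy z hz
    simp only [lp.coeFn_single, Function.mem_support, Pi.single_apply, ne_eq, ite_eq_right_iff,
      one_ne_zero, imp_false, not_not] at hy hz
    rw [hy, hz]

/-- Normalising a nonzero vector of small support gives a unit vector of small support. -/
theorem IsUnitSupportedIn.of_support_subset {X : Type u} [MetricSpace X] [DiscreteTopology X]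
    {v : Ell2 X} (hv : v ≠ 0) {A : Set X} {s : ℝ} (hA : Metric.ediam A ≤ ENNReal.ofReal s)
    (h : ∀ x ∉ A, v x = 0) : IsUnitSupportedIn (((‖v‖⁻¹ : ℝ) : ℂ) • v) s := by
  refine ⟨by simp [norm_smul, hv], le_trans (Metric.ediam_mono ?_) hA⟩
  rw [tsupport_eq_support_of_discrete]
  intro x hx
  by_contra hxA
  exact hx (by simp [h x hxA])

theorem norm_multOp_le {X : Type u} [MetricSpace X] (f : X →ᵇ ℂ) : ‖multOp f‖ ≤ ‖f‖ :=
  lp.norm_mapCLM_le ..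

/-! ### Sparsification implies localisation -/

/-- For suitable signs, a signed sum of vectors is no longer than it would be if the vectors were
orthogonal. -/
theorem exists_signs_norm_sum_sq_le {ι E : Type*} [NormedAddCommGroup E] [InnerProductSpace ℂ E]
    (s : Finset ι) (u : ι → E) : ∃ σ : ι → ℝ, (∀ i, σ i = 1 ∨ σ i = -1) ∧
      ‖∑ i ∈ s, (σ i : ℂ) • u i‖ ^ 2 ≤ ∑ i ∈ s, ‖u i‖ ^ 2 := by
  classical
  induction s using Finset.induction_on with
  | empty => exact ⟨fun _ => 1, fun _ => Or.inl rfl, by simp⟩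
  | insert j s hj ih =>
    obtain ⟨σ, hσ, h⟩ := ih
    set a := ∑ i ∈ s, (σ i : ℂ) • u i with ha
    have hpar := parallelogram_law_with_norm ℂ a (u j)
    have key : ∀ t : ℝ, (∑ i ∈ insert j s, ((Function.update σ j t i : ℝ) : ℂ) • u i)
        = (t : ℂ) • u j + a := by
      intro t
      rw [Finset.sum_insert hj, Function.update_self, ha]
      congr 1
      refine Finset.sum_congr rfl fun i hi => ?_
      rw [Function.update_of_ne (ne_of_mem_of_not_mem hi hj)]
    have hupd : ∀ t : ℝ, (t = 1 ∨ t = -1) →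
        ∀ i, Function.update σ j t i = 1 ∨ Function.update σ j t i = -1 := by
      intro t ht i
      by_cases hij : i = j
      · subst hij
        simpa using ht
      · simpa [Function.update_of_ne hij] using hσ i
    rcases le_total (‖a + u j‖) (‖a - u j‖) with hle | hle
    · refine ⟨Function.update σ j 1, hupd 1 (Or.inl rfl), ?_⟩
      rw [key, Finset.sum_insert hj]
      have : ((1 : ℝ) : ℂ) • u j + a = a + u j := by simp [add_comm]
      rw [this]
      nlinarith [norm_nonneg (a + u j), norm_nonneg (a - u j)]
    · refine ⟨Function.update σ j (-1), hupd (-1) (Or.inr rfl), ?_⟩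
      rw [key, Finset.sum_insert hj]
      have : ((-1 : ℝ) : ℂ) • u j + a = a - u j := by simp [sub_eq_add_neg, add_comm]
      rw [this]
      nlinarith [norm_nonneg (a + u j), norm_nonneg (a - u j)]

theorem le_dist_of_le_setEDist {X : Type u} [MetricSpace X] {A B : Set X} {m : ℕ}
    (h : (m : ℝ≥0∞) ≤ setEDist A B) {x y : X} (hx : x ∈ A) (hy : y ∈ B) : (m : ℝ) ≤ dist x y := by
  have : (m : ℝ≥0∞) ≤ edist x y := h.trans ((iInf₂_le x hx).trans (iInf₂_le y hy))
  rw [edist_dist, ← ENNReal.ofReal_natCast] at this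
  exact (ENNReal.ofReal_le_ofReal_iff dist_nonneg).1 this

/-- A choice of signs on well separated sets extends to a Lipschitz function in the unit ball. -/
theorem exists_lipschitz_extension_of_signs {X : Type u} [MetricSpace X] {ι : Type*}
    {Ω : ι → Set X} {m : ℕ} (hΩ : ∀ i j, i ≠ j → (m : ℝ≥0∞) ≤ setEDist (Ω i) (Ω j))
    (hdisj : ∀ i j, i ≠ j → Disjoint (Ω i) (Ω j)) {L : ℝ≥0} (hm : 2 ≤ L * (m : ℝ)) (σ : ι → ℝ)
    (hσ : ∀ i, σ i = 1 ∨ σ i = -1) :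
    ∃ h : X →ᵇ ℂ, ‖h‖ ≤ 1 ∧ LipschitzWith L h ∧ ∀ i, ∀ x ∈ Ω i, h x = (σ i : ℂ) := by
  classical
  have huniq : ∀ i j x, x ∈ Ω i → x ∈ Ω j → i = j := fun i j x hi hj => by
    by_contra hij
    exact Set.disjoint_left.1 (hdisj i j hij) hi hj
  have habs : ∀ i, |σ i| ≤ 1 := fun i => by rcases hσ i with h | h <;> simp [h]
  let h₀ : X → ℝ := fun x => if hx : ∃ i, x ∈ Ω i then σ hx.choose else 0
  have hh₀ : ∀ i, ∀ x ∈ Ω i, h₀ x = σ i := by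
    intro i x hx
    have hex : ∃ i, x ∈ Ω i := ⟨i, hx⟩
    simp only [h₀, dif_pos hex]
    rw [huniq _ _ _ hex.choose_spec hx]
  have hlip : LipschitzOnWith L h₀ (⋃ i, Ω i) := by
    refine LipschitzOnWith.of_dist_le_mul fun x hx y hy => ?_
    obtain ⟨i, hi⟩ := Set.mem_iUnion.1 hx
    obtain ⟨j, hj⟩ := Set.mem_iUnion.1 hy
    rw [hh₀ i x hi, hh₀ j y hj]
    by_cases hij : i = j
    · subst hij
      rw [dist_self]
      positivity
    · calc dist (σ i) (σ j) ≤ |σ i| + |σ j| := by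
            rw [Real.dist_eq]
            exact abs_sub _ _
        _ ≤ 2 := by linarith [habs i, habs j]
        _ ≤ L * m := hm
        _ ≤ L * dist x y := by
            gcongr
            exact le_dist_of_le_setEDist (hΩ i j hij) hi hj
  obtain ⟨g, hg, hgeq⟩ := hlip.extend_real
  -- clamp the extension to `[-1, 1]`, which does not change it on the sets themselves
  let k : X → ℝ := fun x => max (-1) (min (g x) 1)
  have hk : LipschitzWith L k := by
    have := (hg.min_const 1).const_max (-1)
    simpa [k] using this
  have hkb : ∀ x, |k x| ≤ 1 := fun x =>
    abs_le.2 ⟨le_max_left _ _, max_le (by norm_num) (min_le_right _ _)⟩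
  have hkC : LipschitzWith L (fun x => (k x : ℂ)) := by
    refine LipschitzWith.of_dist_le_mul fun x y => ?_
    rw [Complex.dist_eq, ← Complex.ofReal_sub, Complex.norm_real, ← dist_eq_norm]
    exact hk.dist_le_mul x y
  refine ⟨BoundedContinuousFunction.ofNormedAddCommGroup (fun x => (k x : ℂ)) hkC.continuous 1
    (fun x => by simpa using hkb x), ?_, hkC, fun i x hx => ?_⟩
  · exact BoundedContinuousFunction.norm_ofNormedAddCommGroup_le _ zero_le_one _
  · have hgx : g x = σ i := by rw [← hgeq (Set.mem_iUnion.2 ⟨i, hx⟩), hh₀ i x hx]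
    have hkx : k x = σ i := by
      have := abs_le.1 (habs i)
      simp only [k, hgx]
      rw [min_eq_left this.2, max_eq_right this.1]
    simp [hkx]

/-- A finitely supported weight function defines a finite measure. -/
theorem exists_measure_real_eq_sum {X : Type u} [MeasurableSpace X] [DiscreteMeasurableSpace X]
    (s : Finset X) (w : X → ℝ) (hw : ∀ x, 0 ≤ w x) :
    ∃ μ : Measure X, IsFiniteMeasure μ ∧
      ∀ A : Set X, μ.real A = ∑ x ∈ s, A.indicator w x := by
  classical
  have hval : ∀ A : Set X, (∑ x ∈ s, ENNReal.ofReal (w x) • Measure.dirac x) A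
      = ENNReal.ofReal (∑ x ∈ s, A.indicator w x) := by
    intro A
    rw [Measure.finsetSum_apply, ENNReal.ofReal_sum_of_nonneg
      (fun x _ => Set.indicator_nonneg (fun x _ => hw x) x)]
    refine Finset.sum_congr rfl fun x _ => ?_
    by_cases hx : x ∈ A <;> simp [hx]
  refine ⟨∑ x ∈ s, ENNReal.ofReal (w x) • Measure.dirac x, ⟨?_⟩, fun A => ?_⟩
  · rw [hval]
    exact ENNReal.ofReal_lt_top
  · rw [measureReal_def, hval, ENNReal.toReal_ofReal
      (Finset.sum_nonneg fun x _ => Set.indicator_nonneg (fun x _ => hw x) x)]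

/-- A vector on which `b` almost attains its norm is replaced by its restriction to a sparse set,
whose pieces are then given signs: multiplying by the signs costs only one commutator, and for
suitable signs the images of the pieces add up as if they were orthogonal. So `b` almost attains
its norm on one of the pieces. -/
theorem commutantLocalisationEps_of_metricSparsification {X : Type u} [MetricSpace X] [Nonempty X]
    [MeasurableSpace X] [BorelSpace X] (hX : BoundedGeometry X) (h : MetricSparsification X) :
    CommutantLocalisationEps X := by
  classical
  have := hX.discreteTopology
  have : DiscreteMeasurableSpace X := ⟨fun s => (isOpen_discrete s).measurableSet⟩
  intro ε L M hε hL hM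
  -- `η` bounds the norm of the part of the vector that is thrown away
  obtain ⟨η, hη0, hη1, hηM⟩ : ∃ η : ℝ, 0 < η ∧ η < 1 ∧ M * η ≤ ε / 6 := by
    refine ⟨min (1 / 2) (ε / 6 / M), by positivity,
      (min_le_left _ _).trans_lt (by norm_num), ?_⟩
    calc M * min (1 / 2) (ε / 6 / M) ≤ M * (ε / 6 / M) := by gcongr; exact min_le_right _ _
      _ = ε / 6 := by field_simp
  obtain ⟨f, -, hf⟩ := h (1 - η ^ 2) (by nlinarith) (by nlinarith [pow_pos hη0 2])
  obtain ⟨m, hm⟩ := exists_nat_ge (2 / (L : ℝ))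
  -- at distance `m`, an `L`-Lipschitz function can take the values `1` and `-1`
  have hm' : 2 ≤ L * (m : ℝ) := by
    rw [div_le_iff₀ (by exact_mod_cast hL)] at hm
    linarith
  refine ⟨f m + 1, by positivity, fun b hbM hb => ?_⟩
  rcases lt_or_ge ‖b‖ ε with hsmall | hlarge
  · obtain ⟨x⟩ := ‹Nonempty X›
    exact ⟨lp.single 2 x 1, isUnitSupportedIn_single x _,
      by linarith [norm_nonneg (b (lp.single 2 x 1))]⟩
  obtain ⟨v, F, hvF, hv⟩ := Ell2.exists_finite_support_lt_norm_apply (b := b) (t := ‖b‖ - ε / 6)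
    (by linarith) (by linarith)
  have hv0 : 0 < ‖v‖ := by
    rw [norm_pos_iff]
    rintro rfl
    simp at hv
  obtain ⟨μ, hμfin, hμ⟩ := exists_measure_real_eq_sum F (fun x => ‖v x‖ ^ 2) (fun x => by positivity)
  obtain ⟨ι, Ω, -, hdisj, hsep, hdiam, hmass⟩ := hf m μ
  have huniq : ∀ i j x, x ∈ Ω i → x ∈ Ω j → i = j := fun i j x hi hj => by
    by_contra hij
    exact Set.disjoint_left.1 (hdisj i j hij) hi hj
  -- restriction of functions to a subset
  let res : Set X → Ell2 X → Ell2 X := fun A w => multOp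
    (BoundedContinuousFunction.ofNormedAddCommGroupDiscrete (A.indicator fun _ => (1 : ℂ)) 1
      (fun x => by by_cases hx : x ∈ A <;> simp [hx])) w
  have hres : ∀ A w x, res A w x = A.indicator (w : X → ℂ) x := by
    intro A w x
    simp only [res, multOp_apply, BoundedContinuousFunction.coe_ofNormedAddCommGroupDiscrete]
    by_cases hx : x ∈ A <;> simp [hx]
  -- the finitely many pieces which meet the support of `v`
  let J : Finset ι := F.biUnion fun x => if hx : ∃ i, x ∈ Ω i then {hx.choose} else ∅
  have hJ : ∀ i, ∀ x ∈ F, x ∈ Ω i → i ∈ J := by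
    intro i x hxF hx
    have hex : ∃ i, x ∈ Ω i := ⟨i, hx⟩
    refine Finset.mem_biUnion.2 ⟨x, hxF, ?_⟩
    rw [dif_pos hex, Finset.mem_singleton]
    exact huniq _ _ _ hx hex.choose_spec
  by_contra hno
  push Not at hno
  have hpiece : ∀ i, ‖b (res (Ω i) v)‖ ≤ (‖b‖ - ε) * ‖res (Ω i) v‖ := by
    intro i
    by_cases hz : res (Ω i) v = 0
    · simp [hz]
    have hu := IsUnitSupportedIn.of_support_subset hz (A := Ω i) (s := f m + 1)
      ((hdiam i).trans (by
        rw [← ENNReal.ofReal_natCast]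
        exact ENNReal.ofReal_le_ofReal (by linarith)))
      (fun x hx => by rw [hres, Set.indicator_of_notMem hx])
    have := hno _ hu
    have hpos : 0 < ‖res (Ω i) v‖ := norm_pos_iff.2 hz
    rw [map_smul, norm_smul, Complex.norm_real, Real.norm_eq_abs, abs_of_pos (by positivity),
      inv_mul_lt_iff₀ hpos] at this
    linarith
  obtain ⟨σ, hσ, hσle⟩ := exists_signs_norm_sum_sq_le J (fun i => b (res (Ω i) v))
  obtain ⟨g, hg1, hgL, hgσ⟩ := exists_lipschitz_extension_of_signs hsep hdisj hm' σ hσ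
  set v' := res (⋃ i, Ω i) v with hv'
  have hv'x : ∀ x, v' x = (⋃ i, Ω i).indicator (v : X → ℂ) x := fun x => hres _ _ _
  -- the signed sum of the pieces is `g v'`
  have hgv : multOp g v' = ∑ i ∈ J, (σ i : ℂ) • res (Ω i) v := by
    ext x
    rw [multOp_apply, lp.coeFn_sum, Finset.sum_apply, hv'x]
    simp only [lp.coeFn_smul, Pi.smul_apply, smul_eq_mul, hres]
    by_cases hx : ∃ i, x ∈ Ω i
    · obtain ⟨i, hi⟩ := hx
      rw [Set.indicator_of_mem (Set.mem_iUnion.2 ⟨i, hi⟩), hgσ i x hi]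
      by_cases hxF : x ∈ F
      · rw [Finset.sum_eq_single_of_mem i (hJ i x hxF hi), Set.indicator_of_mem hi]
        intro j _ hji
        rw [Set.indicator_of_notMem fun hj => hji (huniq j i x hj hi), mul_zero]
      · simp [Set.indicator_apply, hvF x hxF]
    · push Not at hx
      simp [hx]
  have hggv : multOp g (multOp g v') = v' := by
    ext x
    rw [multOp_apply, multOp_apply, hv'x]
    by_cases hx : ∃ i, x ∈ Ω i
    · obtain ⟨i, hi⟩ := hx
      rw [hgσ i x hi]
      rcases hσ i with h1 | h1 <;> simp [h1]
    · push Not at hx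
      simp [hx]
  have hnormg : ∀ w : Ell2 X, ‖multOp g w‖ ≤ ‖w‖ := fun w =>
    ((multOp g).le_opNorm w).trans
      (mul_le_of_le_one_left (norm_nonneg _) ((norm_multOp_le g).trans hg1))
  have hv'F : ∀ x ∉ F, v' x = 0 := fun x hx => by
    rw [hv'x, Set.indicator_apply, hvF x hx, ite_self]
  have hv'v : ‖v'‖ ≤ ‖v‖ := by
    refine Ell2.norm_le_of_sum_norm_sq_le (norm_nonneg _) fun s =>
      le_trans (Finset.sum_le_sum fun x _ => ?_) (Ell2.sum_norm_sq_le v s)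
    rw [hv'x]
    gcongr
    exact norm_indicator_le_norm_self _ _
  have hdiff : ‖v - v'‖ ≤ η * ‖v‖ := by
    have h1 : ‖v - v'‖ ^ 2 + ∑ x ∈ F, (⋃ i, Ω i).indicator (fun x => ‖v x‖ ^ 2) x = ‖v‖ ^ 2 := by
      rw [Ell2.norm_sq_eq_sum (v := v - v') (s := F)
        (fun x hx => by rw [lp.coeFn_sub, Pi.sub_apply, hvF x hx, hv'F x hx, sub_zero]),
        Ell2.norm_sq_eq_sum hvF, ← Finset.sum_add_distrib]
      refine Finset.sum_congr rfl fun x _ => ?_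
      rw [lp.coeFn_sub, Pi.sub_apply, hv'x]
      by_cases hx : x ∈ ⋃ i, Ω i
      · simp [Set.indicator_of_mem hx]
      · simp [Set.indicator_of_notMem hx]
    rw [hμ, hμ] at hmass
    simp only [Set.indicator_univ] at hmass
    rw [← Ell2.norm_sq_eq_sum hvF] at hmass
    refine abs_le_of_sq_le_sq' ?_ (by positivity) |>.2
    nlinarith
  have hsum : ∑ i ∈ J, ‖res (Ω i) v‖ ^ 2 ≤ ‖v‖ ^ 2 := by
    have h1 : ∀ i ∈ J, ‖res (Ω i) v‖ ^ 2 = ∑ x ∈ F, (Ω i).indicator (fun x => ‖v x‖ ^ 2) x := by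
      intro i _
      rw [Ell2.norm_sq_eq_sum (s := F)
        (fun x hx => by rw [hres, Set.indicator_apply, hvF x hx, ite_self])]
      refine Finset.sum_congr rfl fun x _ => ?_
      rw [hres]
      by_cases hx : x ∈ Ω i <;> simp [hx]
    rw [Finset.sum_congr rfl h1, Finset.sum_comm, Ell2.norm_sq_eq_sum hvF]
    refine Finset.sum_le_sum fun x _ => ?_
    by_cases hx : ∃ i ∈ J, x ∈ Ω i
    · obtain ⟨i, hiJ, hi⟩ := hx
      rw [Finset.sum_eq_single_of_mem i hiJ, Set.indicator_of_mem hi]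
      intro j _ hji
      exact Set.indicator_of_notMem (fun hj => hji (huniq j i x hj hi)) _
    · push Not at hx
      rw [Finset.sum_eq_zero fun i hi => Set.indicator_of_notMem (hx i hi) _]
      positivity
  have hu : ‖b (multOp g v')‖ ≤ (‖b‖ - ε) * ‖v‖ := by
    refine abs_le_of_sq_le_sq' ?_ (mul_nonneg (by linarith) (norm_nonneg v)) |>.2
    calc ‖b (multOp g v')‖ ^ 2 = ‖∑ i ∈ J, (σ i : ℂ) • b (res (Ω i) v)‖ ^ 2 := by
          rw [hgv, map_sum]
          simp only [map_smul]
      _ ≤ ∑ i ∈ J, ‖b (res (Ω i) v)‖ ^ 2 := hσle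
      _ ≤ ∑ i ∈ J, ((‖b‖ - ε) * ‖res (Ω i) v‖) ^ 2 :=
          Finset.sum_le_sum fun i _ => by gcongr; exact hpiece i
      _ = (‖b‖ - ε) ^ 2 * ∑ i ∈ J, ‖res (Ω i) v‖ ^ 2 := by
          rw [Finset.mul_sum]
          exact Finset.sum_congr rfl fun i _ => mul_pow _ _ _
      _ ≤ (‖b‖ - ε) ^ 2 * ‖v‖ ^ 2 := by gcongr
      _ = ((‖b‖ - ε) * ‖v‖) ^ 2 := (mul_pow _ _ _).symm
  have hcomm : ‖b v'‖ ≤ ‖b (multOp g v')‖ + ε / 6 * ‖v‖ := by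
    have h1 : b v' = (b ∘L multOp g - multOp g ∘L b) (multOp g v') + multOp g (b (multOp g v')) := by
      simp [hggv]
    rw [h1]
    refine (norm_add_le _ _).trans ?_
    have h2 := (b ∘L multOp g - multOp g ∘L b).le_of_opNorm_le (hb g hg1 hgL).le (multOp g v')
    have h3 : ε / 6 * ‖multOp g v'‖ ≤ ε / 6 * ‖v‖ := by
      gcongr
      exact (hnormg v').trans hv'v
    linarith [hnormg (b (multOp g v'))]
  have hcut : ‖b v‖ ≤ ‖b v'‖ + ε / 6 * ‖v‖ := by
    have h1 : b v = b v' + b (v - v') := by rw [← map_add]; simp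
    rw [h1]
    refine (norm_add_le _ _).trans ?_
    gcongr
    calc ‖b (v - v')‖ ≤ ‖b‖ * ‖v - v'‖ := b.le_opNorm _
      _ ≤ M * (η * ‖v‖) := by gcongr
      _ = M * η * ‖v‖ := by ring
      _ ≤ ε / 6 * ‖v‖ := by gcongr
  nlinarith

/-! ### Operators of finite propagation almost commute with Lipschitz functions -/

theorem CommutantLocalisationEps.commutantLocalisationC {X : Type u} [MetricSpace X]
    (h : CommutantLocalisationEps X) : CommutantLocalisationC X := by
  intro c L _ hc1 hL
  obtain ⟨s, hs, H⟩ := h (1 - c) L 1 (by linarith) hL one_pos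
  refine ⟨s, hs, fun b hb hbL => ?_⟩
  obtain ⟨v, hv, hle⟩ := H b hb.le hbL
  exact ⟨v, hv, by linarith⟩

namespace Ell2

/-- The matrix coefficients of an operator of propagation at most `R` vanish off the strip of
width `R` around the diagonal. -/
theorem apply_single_eq_zero_of_propagation {X : Type u} [MetricSpace X] [DiscreteTopology X]
    [DecidableEq X] {a : Ell2 X →L[ℂ] Ell2 X} {R : ℝ} (ha : PropagationAtMost a R) (hR : 0 ≤ R)
    {x y : X} (hxy : R < dist y x) : a (lp.single 2 y 1) x = 0 := by
  let δ : X → X →ᵇ ℂ := fun z =>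
    BoundedContinuousFunction.ofNormedAddCommGroupDiscrete (Pi.single z (1 : ℂ)) 1
      (fun w => by by_cases hw : w = z <;> simp [hw])
  have hsupp : ∀ z, tsupport (δ z) ⊆ {z} := fun z w hw => by
    rw [tsupport_eq_support_of_discrete] at hw
    by_contra hne
    exact hw (Pi.single_eq_of_ne hne _)
  have h := ha (δ x) (δ y) (by
    refine lt_of_lt_of_le ?_ (le_iInf₂ fun x' hx' => le_iInf₂ fun y' hy' => ?_) (b := edist x y)
    · rw [edist_dist, dist_comm]
      exact (ENNReal.ofReal_lt_ofReal_iff (hR.trans_lt hxy)).2 hxy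
    · rw [Set.mem_singleton_iff.1 (hsupp x hx'), Set.mem_singleton_iff.1 (hsupp y hy')])
  have hy : multOp (δ y) (lp.single 2 y 1) = lp.single 2 y 1 := by
    ext w
    by_cases hw : w = y
    · subst hw
      simp [multOp_apply, δ]
    · simp [multOp_apply, hw]
  have h2 : (multOp (δ x) ∘L a ∘L multOp (δ y)) (lp.single 2 y 1) x = 0 := by
    rw [h]
    rfl
  simpa [hy, multOp_apply, δ] using h2

theorem hasSum_apply {X : Type u} [DecidableEq X] (a : Ell2 X →L[ℂ] Ell2 X) (v : Ell2 X) (x : X) :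
    HasSum (fun y => a (lp.single 2 y 1) x * v y) (a v x) := by
  have h := (lp.hasSum_single (p := 2) (by simp) v).mapL
    ((lp.evalCLM (p := 2) ℂ (fun _ : X => ℂ) x) ∘L a)
  refine h.congr_fun fun y => ?_
  have : lp.single 2 y (v y) = v y • (lp.single 2 y (1 : ℂ) : Ell2 X) := by
    rw [← lp.single_smul]
    simp
  rw [this, map_smul]
  exact mul_comm _ _

/-- Schur's test for the commutator of a matrix supported near the diagonal with a Lipschitz
function. -/
theorem norm_commutator_le {X : Type u} [MetricSpace X] [DiscreteTopology X]
    (hX : BoundedGeometry X) {a : Ell2 X →L[ℂ] Ell2 X} {R : ℝ} (ha : PropagationAtMost a R)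
    (hR : 0 ≤ R) (ha1 : ‖a‖ ≤ 1) {N : ℕ} (hN : ∀ x, (hX.ballFinset x R).card ≤ N) {L : ℝ≥0}
    {f : X →ᵇ ℂ} (hf : LipschitzWith L f) :
    ‖a ∘L multOp f - multOp f ∘L a‖ ≤ L * R * N := by
  classical
  have hcoef : ∀ x y, ‖a (lp.single 2 y 1) x‖ ≤ 1 := fun x y =>
    calc ‖a (lp.single 2 y 1) x‖ ≤ ‖a (lp.single 2 y 1)‖ := lp.norm_apply_le_norm (by simp) _ _
      _ ≤ ‖a‖ * ‖(lp.single 2 y 1 : Ell2 X)‖ := a.le_opNorm _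
      _ ≤ 1 := by rw [lp.norm_single (by simp)]; simpa using ha1
  have hrow : ∀ (v : Ell2 X) x,
      a v x = ∑ y ∈ hX.ballFinset x R, a (lp.single 2 y 1) x * v y := by
    intro v x
    refine (hasSum_apply a v x).unique (hasSum_sum_of_ne_finset_zero fun y hy => ?_)
    rw [BoundedGeometry.mem_ballFinset, not_le] at hy
    rw [apply_single_eq_zero_of_propagation ha hR hy, zero_mul]
  refine ContinuousLinearMap.opNorm_le_bound _ (by positivity) fun v => ?_
  have hpt : ∀ x, ‖(a ∘L multOp f - multOp f ∘L a) v x‖ ^ 2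
      ≤ (L * R) ^ 2 * (N * ∑ y ∈ hX.ballFinset x R, ‖v y‖ ^ 2) := by
    intro x
    have hx : (a ∘L multOp f - multOp f ∘L a) v x
        = ∑ y ∈ hX.ballFinset x R, a (lp.single 2 y 1) x * (f y - f x) * v y := by
      change a (multOp f v) x - multOp f (a v) x = _
      rw [multOp_apply, hrow, hrow, Finset.mul_sum, ← Finset.sum_sub_distrib]
      refine Finset.sum_congr rfl fun y _ => ?_
      rw [multOp_apply]
      ring
    have hle : ‖(a ∘L multOp f - multOp f ∘L a) v x‖
        ≤ L * R * ∑ y ∈ hX.ballFinset x R, ‖v y‖ := by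
      rw [hx, Finset.mul_sum]
      refine (norm_sum_le _ _).trans (Finset.sum_le_sum fun y hy => ?_)
      rw [norm_mul, norm_mul]
      refine mul_le_mul_of_nonneg_right ?_ (norm_nonneg _)
      have h1 : ‖f y - f x‖ ≤ L * R := by
        rw [← dist_eq_norm]
        refine (hf.dist_le_mul y x).trans ?_
        gcongr
        exact hX.mem_ballFinset.1 hy
      calc _ ≤ 1 * (L * R) := mul_le_mul (hcoef x y) h1 (norm_nonneg _) zero_le_one
        _ = _ := one_mul _
    calc _ ≤ (L * R * ∑ y ∈ hX.ballFinset x R, ‖v y‖) ^ 2 := by gcongr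
      _ = (L * R) ^ 2 * (∑ y ∈ hX.ballFinset x R, ‖v y‖) ^ 2 := mul_pow _ _ _
      _ ≤ _ := by
        gcongr
        refine sq_sum_le_card_mul_sum_sq.trans ?_
        gcongr
        exact hN x
  refine norm_le_of_sum_norm_sq_le (by positivity) fun s => ?_
  -- each `y` lies in at most `N` of the balls
  have hdouble : ∑ x ∈ s, ∑ y ∈ hX.ballFinset x R, ‖v y‖ ^ 2 ≤ N * ‖v‖ ^ 2 := by
    set U := s.biUnion fun x => hX.ballFinset x R with hU
    calc ∑ x ∈ s, ∑ y ∈ hX.ballFinset x R, ‖v y‖ ^ 2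
        = ∑ y ∈ U, ∑ x ∈ s with dist y x ≤ R, ‖v y‖ ^ 2 := by
          refine Finset.sum_comm' fun x y => ?_
          simp only [BoundedGeometry.mem_ballFinset, Finset.mem_filter, hU, Finset.mem_biUnion]
          constructor
          · rintro ⟨hx, hy⟩
            exact ⟨⟨hx, hy⟩, x, hx, hy⟩
          · rintro ⟨h, -⟩
            exact h
      _ ≤ ∑ y ∈ U, N * ‖v y‖ ^ 2 := by
          refine Finset.sum_le_sum fun y _ => ?_
          rw [Finset.sum_const, nsmul_eq_mul]
          gcongr
          refine le_trans (Finset.card_le_card fun x hx => ?_) (hN y)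
          rw [BoundedGeometry.mem_ballFinset, dist_comm]
          exact (Finset.mem_filter.1 hx).2
      _ ≤ N * ‖v‖ ^ 2 := by
          rw [← Finset.mul_sum]
          gcongr
          exact sum_norm_sq_le v U
  calc _ ≤ ∑ x ∈ s, (L * R) ^ 2 * (N * ∑ y ∈ hX.ballFinset x R, ‖v y‖ ^ 2) :=
        Finset.sum_le_sum fun x _ => hpt x
    _ = (L * R) ^ 2 * (N * ∑ x ∈ s, ∑ y ∈ hX.ballFinset x R, ‖v y‖ ^ 2) := by
        simp only [Finset.mul_sum]
    _ ≤ (L * R) ^ 2 * (N * (N * ‖v‖ ^ 2)) := by gcongr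
    _ = _ := by ring

end Ell2

theorem CommutantLocalisationC.operatorNormLocalisation {X : Type u} [MetricSpace X]
    (hX : BoundedGeometry X) (h : CommutantLocalisationC X) : OperatorNormLocalisation X := by
  have := hX.discreteTopology
  intro c R hc0 hc1 hR
  obtain ⟨N, hN⟩ := hX.exists_card_ballFinset_le R
  have hL : 0 < (1 - c) / 6 / (R * (N + 1)) := div_pos (by linarith) (by positivity)
  obtain ⟨s, hs, H⟩ := h c ⟨_, hL.le⟩ hc0 hc1 hL
  refine ⟨s, hs, fun a ha ha1 => H a ha1 fun f _ hf => ?_⟩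
  refine (Ell2.norm_commutator_le hX ha hR.le ha1.le hN hf).trans_lt ?_
  change (1 - c) / 6 / (R * (N + 1)) * R * N < (1 - c) / 6
  have : (1 - c) / 6 / (R * (N + 1)) * R * N = (1 - c) / 6 * (N / (N + 1)) := by
    field_simp
  rw [this]
  refine mul_lt_of_lt_one_right (by linarith) ?_
  rw [div_lt_one (by positivity)]
  linarith

/-! ### Norm localisation for matrices with nonnegative entries -/

namespace Ell2

/-- The finite-rank operator on `ℓ²(X)` with the real matrix `b`, cut down to `s × s`. -/
noncomputable def ofMatrix {X : Type u} [DecidableEq X] (s : Finset X) (b : X → X → ℝ) :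
    Ell2 X →L[ℂ] Ell2 X :=
  ∑ x ∈ s, ∑ y ∈ s, (b x y : ℂ) • (lp.singleContinuousLinearMap ℂ (fun _ : X => ℂ) 2 x ∘L
    lp.evalCLM (p := 2) ℂ (fun _ : X => ℂ) y)

theorem ofMatrix_apply {X : Type u} [DecidableEq X] (s : Finset X) (b : X → X → ℝ) (v : Ell2 X)
    (z : X) : ofMatrix s b v z = if z ∈ s then ∑ y ∈ s, (b z y : ℂ) * v y else 0 := by
  have h : ∀ x y : X, (((b x y : ℂ) • (lp.singleContinuousLinearMap ℂ (fun _ : X => ℂ) 2 x ∘L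
      lp.evalCLM (p := 2) ℂ (fun _ : X => ℂ) y)) v : Ell2 X) z
      = if z = x then (b x y : ℂ) * v y else 0 := by
    intro x y
    change (b x y : ℂ) * (Pi.single x (v y) : X → ℂ) z = _
    rw [Pi.single_apply, mul_ite, mul_zero]
  simp only [ofMatrix, sum_apply, lp.coeFn_sum, Finset.sum_apply, h]
  rw [Finset.sum_comm]
  by_cases hz : z ∈ s
  · simp [hz]
  · simp [hz]

theorem propagationAtMost_ofMatrix {X : Type u} [MetricSpace X] [DecidableEq X] (s : Finset X)
    {b : X → X → ℝ} {R : ℝ} (hb : ∀ x y, R < dist x y → b x y = 0) :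
    PropagationAtMost (ofMatrix s b) R := by
  intro f f' hff'
  ext v z
  change multOp f (ofMatrix s b (multOp f' v)) z = 0
  rw [multOp_apply, ofMatrix_apply]
  split_ifs with hz
  · rw [Finset.mul_sum]
    refine Finset.sum_eq_zero fun y _ => ?_
    rw [multOp_apply]
    by_cases hfz : f z = 0
    · simp [hfz]
    by_cases hfy : f' y = 0
    · simp [hfy]
    have hlt : ENNReal.ofReal R < edist z y := hff'.trans_le
      ((iInf₂_le z (subset_tsupport _ hfz)).trans (iInf₂_le y (subset_tsupport _ hfy)))
    rw [edist_dist] at hlt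
    rw [hb z y (ENNReal.ofReal_lt_ofReal_iff'.1 hlt).1]
    simp
  · simp

end Ell2

/-- If a symmetric matrix with nonnegative entries is dominated by the identity on vectors of small
support, then norm localisation bounds its norm: polarisation turns the bound for the quadratic
form into one for the bilinear form, which is what `‖B v‖` needs. -/
theorem mul_norm_ofMatrix_le_one {X : Type u} [MetricSpace X] [DecidableEq X]
    {c R S : ℝ} (hR : 0 ≤ R) (hS : 0 ≤ S)
    (H : ∀ a : Ell2 X →L[ℂ] Ell2 X, PropagationAtMost a R → ‖a‖ = 1 →
      ∃ v : Ell2 X, IsUnitSupportedIn v S ∧ c ≤ ‖a v‖)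
    (s : Finset X) {b : X → X → ℝ} (hb0 : ∀ x y, 0 ≤ b x y) (hsymm : ∀ x y, b x y = b y x)
    (hbR : ∀ x y, R < dist x y → b x y = 0)
    (hloc : ∀ ξ : X → ℝ, (∀ x, 0 ≤ ξ x) →
      (∀ x y, ξ x ≠ 0 → ξ y ≠ 0 → dist x y ≤ S + 2 * R) →
      ∑ x ∈ s, ∑ y ∈ s, b x y * (ξ x * ξ y) ≤ ∑ x ∈ s, ξ x ^ 2) :
    c * ‖Ell2.ofMatrix s b‖ ≤ 1 := by
  set B := Ell2.ofMatrix s b with hB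
  rcases (norm_nonneg B).eq_or_lt with h0 | h0
  · rw [← h0]
    simp
  obtain ⟨v, ⟨hv1, hvS⟩, hv⟩ := H (((‖B‖⁻¹ : ℝ) : ℂ) • B)
    (by
      intro f f' hff'
      have := Ell2.propagationAtMost_ofMatrix s hbR f f' hff'
      rw [ContinuousLinearMap.smul_comp, ContinuousLinearMap.comp_smul, this, smul_zero])
    (by rw [norm_smul]; simp [h0.ne'])
  have hv' : c * ‖B‖ ≤ ‖B v‖ := by
    rw [smul_apply, norm_smul, Complex.norm_real, Real.norm_eq_abs,
      abs_of_pos (by positivity), le_inv_mul_iff₀ h0] at hv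
    linarith
  refine hv'.trans ?_
  set G := ‖B v‖ with hG
  rcases (norm_nonneg (B v)).eq_or_lt with hG0 | hG0
  · linarith
  -- the bilinear form is polarised at the nonnegative vectors `g = |B v|` and `w = |v|`
  set g : X → ℝ := fun x => ‖B v x‖ with hg
  set w : X → ℝ := fun x => ‖v x‖ with hw
  have hgle : ∀ x, g x ≤ ∑ y ∈ s, b x y * w y := by
    intro x
    simp only [hg, hB, Ell2.ofMatrix_apply]
    split_ifs with hx
    · refine (norm_sum_le _ _).trans (le_of_eq (Finset.sum_congr rfl fun y _ => ?_))
      rw [norm_mul, Complex.norm_real, Real.norm_eq_abs, abs_of_nonneg (hb0 x y)]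
    · rw [norm_zero]
      exact Finset.sum_nonneg fun y _ => mul_nonneg (hb0 x y) (norm_nonneg _)
  have hgs : ∑ x ∈ s, g x ^ 2 = G ^ 2 := by
    rw [hG, Ell2.norm_sq_eq_sum (v := B v) (s := s)]
    intro x hx
    rw [hB, Ell2.ofMatrix_apply, if_neg hx]
  have hws : ∑ x ∈ s, w x ^ 2 ≤ 1 := by
    have := Ell2.sum_norm_sq_le v s
    rwa [hv1, one_pow] at this
  have hwS : ∀ x y, w x ≠ 0 → w y ≠ 0 → dist x y ≤ S := by
    intro x y hx hy
    have h1 := (Metric.edist_le_ediam_of_mem (subset_tsupport (v : X → ℂ) (norm_ne_zero_iff.1 hx))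
      (subset_tsupport (v : X → ℂ) (norm_ne_zero_iff.1 hy))).trans hvS
    rw [edist_dist] at h1
    exact (ENNReal.ofReal_le_ofReal_iff hS).1 h1
  have hnear : ∀ x, (g x ≠ 0 ∨ w x ≠ 0) → ∃ y, w y ≠ 0 ∧ dist x y ≤ R := by
    rintro x (hx | hx)
    · have hpos : 0 < ∑ y ∈ s, b x y * w y := ((norm_nonneg _).lt_of_ne' hx).trans_le (hgle x)
      obtain ⟨y, -, hy⟩ := Finset.exists_ne_zero_of_sum_ne_zero hpos.ne'
      refine ⟨y, right_ne_zero_of_mul hy, ?_⟩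
      by_contra hlt
      exact left_ne_zero_of_mul hy (hbR x y (not_le.1 hlt))
    · exact ⟨x, hx, by simpa using hR⟩
  have hlocal : ∀ x y, (g x ≠ 0 ∨ w x ≠ 0) → (g y ≠ 0 ∨ w y ≠ 0) → dist x y ≤ S + 2 * R := by
    intro x y hx hy
    obtain ⟨x', hx', hxx'⟩ := hnear x hx
    obtain ⟨y', hy', hyy'⟩ := hnear y hy
    have := hwS x' y' hx' hy'
    have h4 := dist_triangle4 x x' y' y
    rw [dist_comm y' y] at h4
    linarith
  have hzero : ∀ x, ¬ (g x ≠ 0 ∨ w x ≠ 0) → g x = 0 ∧ w x = 0 := by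
    intro x hx
    push Not at hx
    exact hx
  have h1 := hloc (fun x => g x + G * w x)
    (fun x => add_nonneg (norm_nonneg _) (mul_nonneg hG0.le (norm_nonneg _)))
    (fun x y hx hy => hlocal x y
      (by by_contra h; exact hx (by simp [hzero x h]))
      (by by_contra h; exact hy (by simp [hzero y h])))
  have h2 := hloc (fun x => |g x - G * w x|) (fun x => abs_nonneg _)
    (fun x y hx hy => hlocal x y
      (by by_contra h; exact hx (by simp [hzero x h]))
      (by by_contra h; exact hy (by simp [hzero y h])))
  have hbil : G ^ 2 ≤ ∑ x ∈ s, ∑ y ∈ s, b x y * (g x * w y) := by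
    rw [← hgs]
    refine Finset.sum_le_sum fun x _ => ?_
    calc g x ^ 2 = g x * g x := sq _
      _ ≤ g x * ∑ y ∈ s, b x y * w y := mul_le_mul_of_nonneg_left (hgle x) (norm_nonneg _)
      _ = ∑ y ∈ s, b x y * (g x * w y) := by
          rw [Finset.mul_sum]
          exact Finset.sum_congr rfl fun y _ => by ring
  have hswap : ∑ x ∈ s, ∑ y ∈ s, b x y * (w x * g y) = ∑ x ∈ s, ∑ y ∈ s, b x y * (g x * w y) := by
    rw [Finset.sum_comm]
    refine Finset.sum_congr rfl fun x _ => Finset.sum_congr rfl fun y _ => ?_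
    rw [hsymm y x]
    ring
  have hpol : 2 * G * (∑ x ∈ s, ∑ y ∈ s, b x y * (g x * w y)
        + ∑ x ∈ s, ∑ y ∈ s, b x y * (w x * g y))
      ≤ ∑ x ∈ s, ∑ y ∈ s, b x y * ((g x + G * w x) * (g y + G * w y))
        + ∑ x ∈ s, ∑ y ∈ s, b x y * (|g x - G * w x| * |g y - G * w y|) := by
    simp only [← Finset.sum_add_distrib, Finset.mul_sum]
    refine Finset.sum_le_sum fun x _ => Finset.sum_le_sum fun y _ => ?_
    have h3 := neg_abs_le ((g x - G * w x) * (g y - G * w y))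
    rw [abs_mul] at h3
    have h4 := mul_le_mul_of_nonneg_left h3 (hb0 x y)
    nlinarith
  have hsq : ∑ x ∈ s, (g x + G * w x) ^ 2 + ∑ x ∈ s, |g x - G * w x| ^ 2
      = 2 * ∑ x ∈ s, g x ^ 2 + 2 * G ^ 2 * ∑ x ∈ s, w x ^ 2 := by
    rw [Finset.mul_sum, Finset.mul_sum, ← Finset.sum_add_distrib, ← Finset.sum_add_distrib]
    refine Finset.sum_congr rfl fun x _ => ?_
    rw [sq_abs]
    ring
  have hfin : 4 * G * G ^ 2 ≤ 4 * G ^ 2 := by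
    rw [hswap] at hpol
    nlinarith [mul_le_mul_of_nonneg_left hws (sq_nonneg G),
      mul_le_mul_of_nonneg_left hbil hG0.le]
  have hG2 : 0 < G ^ 2 := by positivity
  nlinarith

/-- For strictly positive `α` the matrix `A x y / √(α x * α y)` is locally dominated by the
identity, and testing its norm on the vector `√α` gives the claim. -/
theorem mul_sum_le_sum_of_pos {X : Type u} [MetricSpace X]
    {c R S : ℝ} (hc : 0 ≤ c) (hR : 0 ≤ R) (hS : 0 ≤ S)
    (H : ∀ a : Ell2 X →L[ℂ] Ell2 X, PropagationAtMost a R → ‖a‖ = 1 →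
      ∃ v : Ell2 X, IsUnitSupportedIn v S ∧ c ≤ ‖a v‖)
    (s : Finset X) {α : X → ℝ} (hα : ∀ x, 0 < α x) {A : X → X → ℝ} (hA0 : ∀ x y, 0 ≤ A x y)
    (hsymm : ∀ x y, A x y = A y x) (hAR : ∀ x y, R < dist x y → A x y = 0)
    (hloc : ∀ ξ : X → ℝ, (∀ x, 0 ≤ ξ x) →
      (∀ x y, ξ x ≠ 0 → ξ y ≠ 0 → dist x y ≤ S + 2 * R) →
      ∑ x ∈ s, ∑ y ∈ s, A x y * (ξ x * ξ y) ≤ ∑ x ∈ s, α x * ξ x ^ 2) :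
    c * ∑ x ∈ s, ∑ y ∈ s, A x y ≤ ∑ x ∈ s, α x := by
  classical
  have hq : ∀ x, 0 < √(α x) := fun x => Real.sqrt_pos.2 (hα x)
  have hq2 : ∀ x, √(α x) ^ 2 = α x := fun x => Real.sq_sqrt (hα x).le
  set b : X → X → ℝ := fun x y => A x y / (√(α x) * √(α y)) with hb
  have hbA : ∀ x y, √(α x) * (b x y * √(α y)) = A x y := fun x y => by
    have := (hq x).ne'
    have := (hq y).ne'
    simp only [hb]
    field_simp
  have hnorm := mul_norm_ofMatrix_le_one hR hS H s (b := b)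
    (fun x y => div_nonneg (hA0 x y) (by positivity))
    (fun x y => by simp only [hb]; rw [hsymm x y, mul_comm])
    (fun x y hxy => by simp only [hb]; rw [hAR x y hxy, zero_div])
    (fun ξ hξ0 hξ => by
      have := hloc (fun x => ξ x / √(α x)) (fun x => div_nonneg (hξ0 x) (hq x).le)
        (fun x y hx hy => hξ x y (fun h => hx (by simp [h])) (fun h => hy (by simp [h])))
      refine le_trans (le_of_eq ?_) (this.trans (le_of_eq ?_))
      · refine Finset.sum_congr rfl fun x _ => Finset.sum_congr rfl fun y _ => ?_
        simp only [hb]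
        have := (hq x).ne'
        have := (hq y).ne'
        field_simp
      · refine Finset.sum_congr rfl fun x _ => ?_
        rw [div_pow, hq2]
        have := (hα x).ne'
        field_simp)
  set B := Ell2.ofMatrix s b with hB
  let q : Ell2 X := ∑ x ∈ s, lp.single 2 x ((√(α x) : ℝ) : ℂ)
  have hqx : ∀ x, q x = if x ∈ s then ((√(α x) : ℝ) : ℂ) else 0 := by
    intro x
    simp only [q, lp.coeFn_sum, lp.coeFn_single, Finset.sum_apply, Finset.sum_pi_single]
  have hqn : ‖q‖ ^ 2 = ∑ x ∈ s, α x := by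
    rw [Ell2.norm_sq_eq_sum (v := q) (s := s) (fun x hx => by rw [hqx, if_neg hx])]
    refine Finset.sum_congr rfl fun x hx => ?_
    rw [hqx, if_pos hx, Complex.norm_real, Real.norm_eq_abs, sq_abs, hq2]
  have hsum : ∑ x ∈ s, ∑ y ∈ s, A x y ≤ ∑ x ∈ s, √(α x) * ‖B q x‖ := by
    refine Finset.sum_le_sum fun x hx => ?_
    have h1 : B q x = ((∑ y ∈ s, b x y * √(α y) : ℝ) : ℂ) := by
      rw [hB, Ell2.ofMatrix_apply, if_pos hx]
      push_cast
      refine Finset.sum_congr rfl fun y hy => ?_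
      rw [hqx, if_pos hy]
    rw [h1, Complex.norm_real]
    refine le_trans (le_of_eq ?_) (mul_le_mul_of_nonneg_left (le_abs_self _) (hq x).le)
    rw [Finset.mul_sum]
    exact Finset.sum_congr rfl fun y _ => (hbA x y).symm
  have hcs : ∑ x ∈ s, √(α x) * ‖B q x‖ ≤ ‖B‖ * ∑ x ∈ s, α x := by
    refine abs_le_of_sq_le_sq' ?_ (mul_nonneg (norm_nonneg _)
      (Finset.sum_nonneg fun x _ => (hα x).le)) |>.2
    calc (∑ x ∈ s, √(α x) * ‖B q x‖) ^ 2
        ≤ (∑ x ∈ s, √(α x) ^ 2) * ∑ x ∈ s, ‖B q x‖ ^ 2 := Finset.sum_mul_sq_le_sq_mul_sq _ _ _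
      _ ≤ (∑ x ∈ s, α x) * (‖B‖ * ‖q‖) ^ 2 := by
          simp only [hq2]
          refine mul_le_mul_of_nonneg_left ?_ (Finset.sum_nonneg fun x _ => (hα x).le)
          refine (Ell2.sum_norm_sq_le _ _).trans ?_
          gcongr
          exact B.le_opNorm q
      _ = (‖B‖ * ∑ x ∈ s, α x) ^ 2 := by
          rw [mul_pow, hqn]
          ring
  calc c * ∑ x ∈ s, ∑ y ∈ s, A x y ≤ c * (‖B‖ * ∑ x ∈ s, α x) :=
        mul_le_mul_of_nonneg_left (hsum.trans hcs) hc
    _ = (c * ‖B‖) * ∑ x ∈ s, α x := by ring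
    _ ≤ 1 * ∑ x ∈ s, α x :=
        mul_le_mul_of_nonneg_right hnorm (Finset.sum_nonneg fun x _ => (hα x).le)
    _ = _ := one_mul _

/-- If the quadratic form of a matrix `A` with nonnegative entries is dominated by the diagonal
form `α` on vectors of small support, then norm localisation makes the total mass of `A` at most
that of `α`, up to the factor `c`. -/
theorem mul_sum_le_sum_of_nonneg {X : Type u} [MetricSpace X]
    {c R S : ℝ} (hc : 0 ≤ c) (hR : 0 ≤ R) (hS : 0 ≤ S)
    (H : ∀ a : Ell2 X →L[ℂ] Ell2 X, PropagationAtMost a R → ‖a‖ = 1 →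
      ∃ v : Ell2 X, IsUnitSupportedIn v S ∧ c ≤ ‖a v‖)
    (s : Finset X) {α : X → ℝ} (hα : ∀ x, 0 ≤ α x) {A : X → X → ℝ} (hA0 : ∀ x y, 0 ≤ A x y)
    (hsymm : ∀ x y, A x y = A y x) (hAR : ∀ x y, R < dist x y → A x y = 0)
    (hloc : ∀ ξ : X → ℝ, (∀ x, 0 ≤ ξ x) →
      (∀ x y, ξ x ≠ 0 → ξ y ≠ 0 → dist x y ≤ S + 2 * R) →
      ∑ x ∈ s, ∑ y ∈ s, A x y * (ξ x * ξ y) ≤ ∑ x ∈ s, α x * ξ x ^ 2) :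
    c * ∑ x ∈ s, ∑ y ∈ s, A x y ≤ ∑ x ∈ s, α x := by
  refine le_of_forall_pos_le_add fun η hη => ?_
  have h := mul_sum_le_sum_of_pos hc hR hS H s (α := fun x => α x + η / (s.card + 1))
    (fun x => add_pos_of_nonneg_of_pos (hα x) (by positivity)) hA0 hsymm hAR
    (fun ξ hξ0 hξ => (hloc ξ hξ0 hξ).trans (Finset.sum_le_sum fun x _ => by
      have : 0 ≤ η / (s.card + 1) * ξ x ^ 2 := by positivity
      linarith))
  rw [Finset.sum_add_distrib, Finset.sum_const, nsmul_eq_mul] at h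
  have h2 : s.card * (η / (s.card + 1)) ≤ η := by
    rw [mul_div_assoc', div_le_iff₀ (by positivity)]
    linarith
  linarith

/-! ### Duality -/

/-- A minimax principle: if every nonzero nonnegative weight is positive on some point of a convex
set, then some point of the convex set has positive coordinates. -/
theorem exists_mem_forall_pos_of_convex {J : Type*} {C : Set (J → ℝ)} (hC : Convex ℝ C)
    (hne : C.Nonempty) (s : Finset J)
    (h : ∀ w : J → ℝ, (∀ j, 0 ≤ w j) → (∃ j ∈ s, 0 < w j) → ∃ c ∈ C, 0 < ∑ j ∈ s, w j * c j) :
    ∃ c ∈ C, ∀ j ∈ s, 0 < c j := by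
  classical
  by_contra hcon
  push Not at hcon
  let ρ : (J → ℝ) →ₗ[ℝ] (s → ℝ) := LinearMap.funLeft ℝ ℝ ((↑) : s → J)
  let U : Set (s → ℝ) := {d | ∀ j, 0 < d j}
  have hU : Convex ℝ U := by
    intro d hd d' hd' a b ha hb hab j
    change 0 < a * d j + b * d' j
    rcases ha.eq_or_lt with rfl | ha
    · rw [zero_add] at hab
      simpa [hab] using hd' j
    · exact add_pos_of_pos_of_nonneg (mul_pos ha (hd j)) (mul_nonneg hb (hd' j).le)
  have hUo : IsOpen U := by
    simp only [U, Set.ofPred_forall]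
    exact isOpen_iInter_of_finite fun j => isOpen_lt continuous_const (continuous_apply j)
  have hdisj : Disjoint U (ρ '' C) := by
    rw [Set.disjoint_right]
    rintro _ ⟨c, hc, rfl⟩ hcU
    obtain ⟨j, hj, hle⟩ := hcon c hc
    exact absurd (hcU ⟨j, hj⟩) (not_lt.2 hle)
  obtain ⟨f, u, hfU, hfC⟩ := geometric_hahn_banach_open hU hUo (hC.linear_image ρ) hdisj
  let e : s → ℝ := fun j => f (Pi.single j 1)
  have hf : ∀ d : s → ℝ, f d = ∑ j, d j * e j := fun d => by
    conv_lhs => rw [pi_eq_sum_univ' d]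
    simp only [map_sum, map_smul, smul_eq_mul, e]
  have hone : f 1 < u := hfU 1 fun j => one_pos
  have he : ∀ j, e j ≤ 0 := by
    intro j
    by_contra hpos
    push Not at hpos
    have hlt := hfU (1 + ((u - f 1) / e j) • Pi.single j 1) (fun i => by
      have h1 : 0 ≤ (u - f 1) / e j := div_nonneg (by linarith) hpos.le
      have h2 : (0 : ℝ) ≤ (Pi.single j (1 : ℝ) : s → ℝ) i := by
        rw [Pi.single_apply]
        split_ifs <;> norm_num
      have h3 := mul_nonneg h1 h2
      simp only [Pi.add_apply, Pi.one_apply, Pi.smul_apply, smul_eq_mul]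
      linarith)
    rw [map_add, map_smul, smul_eq_mul, div_mul_cancel₀ _ hpos.ne'] at hlt
    linarith
  have hu : 0 ≤ u := by
    by_contra hneg
    push Not at hneg
    have h1 : f 1 < 0 := hone.trans hneg
    have hlt := hfU ((u / f 1) • 1) (fun i => by
      simpa using div_pos_of_neg_of_neg hneg h1)
    rw [map_smul, smul_eq_mul, div_mul_cancel₀ _ h1.ne] at hlt
    exact lt_irrefl _ hlt
  -- minus the separating functional is the weight that contradicts the hypothesis
  let w : J → ℝ := fun j => if hj : j ∈ s then - e ⟨j, hj⟩ else 0
  have hsum : ∀ c : J → ℝ, ∑ j ∈ s, w j * c j = - f (ρ c) := by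
    intro c
    rw [hf, ← Finset.sum_coe_sort s, ← Finset.sum_neg_distrib]
    refine Finset.sum_congr rfl fun j _ => ?_
    simp only [w, dif_pos j.2, ρ, LinearMap.funLeft_apply]
    ring
  obtain ⟨c, hc, hpos⟩ := h w
    (fun j => by
      by_cases hj : j ∈ s
      · simp only [w, dif_pos hj]
        linarith [he ⟨j, hj⟩]
      · simp [w, hj])
    (by
      by_contra hzero
      push Not at hzero
      have he0 : ∀ j, e j = 0 := fun j => by
        have := hzero j j.2
        simp only [w, dif_pos j.2] at this
        exact le_antisymm (he j) (by linarith)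
      have hf0 : ∀ d, f d = 0 := fun d => by rw [hf]; simp [he0]
      obtain ⟨c, hc⟩ := hne
      have h1 := hfC _ ⟨c, hc, rfl⟩
      rw [hf0] at h1 hone
      linarith)
  rw [hsum] at hpos
  linarith [hfC _ ⟨c, hc, rfl⟩]

theorem add_mul_sqrt_le_sqrt {a b a' b' s t : ℝ} (ha : 0 ≤ a) (hb : 0 ≤ b) (ha' : 0 ≤ a')
    (hb' : 0 ≤ b') (hs : 0 ≤ s) (ht : 0 ≤ t) :
    s * √(a * b) + t * √(a' * b') ≤ √((s * a + t * a') * (s * b + t * b')) := by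
  refine Real.le_sqrt_of_sq_le ?_
  have h1 : 2 * (√(a * b) * √(a' * b')) ≤ a * b' + a' * b := by
    have : √(a * b) * √(a' * b') = √(a * b') * √(a' * b) := by
      rw [← Real.sqrt_mul (by positivity), ← Real.sqrt_mul (by positivity)]
      congr 1
      ring
    rw [this]
    nlinarith [Real.sq_sqrt (mul_nonneg ha hb'), Real.sq_sqrt (mul_nonneg ha' hb),
      sq_nonneg (√(a * b') - √(a' * b))]
  calc (s * √(a * b) + t * √(a' * b')) ^ 2
      = s ^ 2 * √(a * b) ^ 2 + t ^ 2 * √(a' * b') ^ 2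
        + s * t * (2 * (√(a * b) * √(a' * b'))) := by ring
    _ = s ^ 2 * (a * b) + t ^ 2 * (a' * b') + s * t * (2 * (√(a * b) * √(a' * b'))) := by
        rw [Real.sq_sqrt (mul_nonneg ha hb), Real.sq_sqrt (mul_nonneg ha' hb')]
    _ ≤ s ^ 2 * (a * b) + t ^ 2 * (a' * b') + s * t * (a * b' + a' * b) := by gcongr
    _ = (s * a + t * a') * (s * b + t * b') := by ring

/-- The dual formulation of Property A on a finite set: a kernel whose rows have mass at most one,
and have large affinity (the sum of the geometric means) at points of distance at most `R`.
The affinity is a concave function of the kernel, so that by the minimax principle it suffices to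
find a kernel for each weight on the constraints. For this either a single local vector or the zero
kernel serves; the bound needed in the second case is `mul_sum_le_sum_of_nonneg`. -/
theorem exists_kernel_of_localisation {X : Type u} [MetricSpace X] (hX : BoundedGeometry X)
    {ε R S : ℝ} (hε : 0 < ε) (hε1 : ε ≤ 1) (hR : 0 ≤ R) (hS : 0 ≤ S)
    (H : ∀ a : Ell2 X →L[ℂ] Ell2 X, PropagationAtMost a R → ‖a‖ = 1 →
      ∃ v : Ell2 X, IsUnitSupportedIn v S ∧ 1 - ε / 2 ≤ ‖a v‖) (F : Finset X) :
    ∃ w : X → X → ℝ, (∀ x z, 0 ≤ w x z) ∧ (∀ x z, S + 2 * R < dist z x → w x z = 0) ∧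
      (∀ x ∈ F, ∑ z ∈ hX.ballFinset x (S + 2 * R), w x z ≤ 1) ∧
      ∀ x ∈ F, ∀ y ∈ F, dist x y ≤ R →
        1 - ε ≤ ∑ z ∈ hX.ballFinset x (S + 2 * R), √(w x z * w y z) := by
  classical
  set D := S + 2 * R
  let E : Finset (X × X) := {e ∈ F ×ˢ F | dist e.1 e.2 ≤ R}
  have hE : ∀ x y, (x, y) ∈ E ↔ x ∈ F ∧ y ∈ F ∧ dist x y ≤ R := fun x y => by
    simp [E, and_assoc]
  let C : Set (X ⊕ (X × X) → ℝ) := {c | ∃ w : X → X → ℝ, (∀ x z, 0 ≤ w x z) ∧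
    (∀ x z, D < dist z x → w x z = 0) ∧
    (∀ x, c (Sum.inl x) ≤ 1 - ∑ z ∈ hX.ballFinset x D, w x z) ∧
    ∀ x y, c (Sum.inr (x, y)) ≤ ∑ z ∈ hX.ballFinset x D, √(w x z * w y z) - (1 - ε)}
  have hC : Convex ℝ C := by
    rintro c ⟨w, hw0, hwD, hw1, hw2⟩ c' ⟨w', hw0', hwD', hw1', hw2'⟩ a b ha hb hab
    refine ⟨fun x z => a * w x z + b * w' x z,
      fun x z => add_nonneg (mul_nonneg ha (hw0 x z)) (mul_nonneg hb (hw0' x z)),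
      fun x z hxz => by simp [hwD x z hxz, hwD' x z hxz], fun x => ?_, fun x y => ?_⟩
    · have h1 := mul_le_mul_of_nonneg_left (hw1 x) ha
      have h2 := mul_le_mul_of_nonneg_left (hw1' x) hb
      rw [Finset.sum_add_distrib, ← Finset.mul_sum, ← Finset.mul_sum]
      simp only [Pi.add_apply, Pi.smul_apply, smul_eq_mul]
      nlinarith
    · have h1 := mul_le_mul_of_nonneg_left (hw2 x y) ha
      have h2 := mul_le_mul_of_nonneg_left (hw2' x y) hb
      have h3 : a * ∑ z ∈ hX.ballFinset x D, √(w x z * w y z)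
          + b * ∑ z ∈ hX.ballFinset x D, √(w' x z * w' y z)
          ≤ ∑ z ∈ hX.ballFinset x D,
            √((a * w x z + b * w' x z) * (a * w y z + b * w' y z)) := by
        rw [Finset.mul_sum, Finset.mul_sum, ← Finset.sum_add_distrib]
        exact Finset.sum_le_sum fun z _ => add_mul_sqrt_le_sqrt (hw0 x z) (hw0 y z) (hw0' x z)
          (hw0' y z) ha hb
      simp only [Pi.add_apply, Pi.smul_apply, smul_eq_mul]
      have h4 : a * (1 - ε) + b * (1 - ε) = 1 - ε := by rw [← add_mul, hab, one_mul]
      linarith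
  have hzero : (Sum.elim (fun _ => 1) (fun _ => -(1 - ε)) : X ⊕ (X × X) → ℝ) ∈ C :=
    ⟨fun _ _ => 0, fun _ _ => le_rfl, fun _ _ _ => rfl, fun _ => by simp, fun _ _ => by simp⟩
  obtain ⟨c, ⟨w, hw0, hwD, hw1, hw2⟩, hpos⟩ :=
    exists_mem_forall_pos_of_convex hC ⟨_, hzero⟩ (F.disjSum E) (by
      intro ω hω0 hωpos
      set α : X → ℝ := fun x => ω (Sum.inl x)
      set β : X × X → ℝ := fun e => ω (Sum.inr e)
      by_cases hcase : ∃ ξ : X → ℝ, (∀ x, 0 ≤ ξ x) ∧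
          (∀ x y, ξ x ≠ 0 → ξ y ≠ 0 → dist x y ≤ D) ∧
          ∑ x ∈ F, α x * ξ x ^ 2 < ∑ e ∈ E, β e * (ξ e.1 * ξ e.2)
      · obtain ⟨ξ, hξ0, hξ, hlt⟩ := hcase
        obtain ⟨z₀, hz₀⟩ : ∃ z, ξ z ≠ 0 := by
          by_contra hall
          push Not at hall
          simp [hall] at hlt
        set gap := ∑ e ∈ E, β e * (ξ e.1 * ξ e.2) - ∑ x ∈ F, α x * ξ x ^ 2 with hgap
        have hgap0 : 0 < gap := by linarith
        -- the multiple of `ξ ⊗ ξ` is chosen so large that it outweighs the constant terms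
        set K := ∑ x ∈ F, α x - (1 - ε) * ∑ e ∈ E, β e
        set T := (|K| + 1) / gap
        have hT0 : 0 ≤ T := by positivity
        have hball : ∀ x, ξ x ≠ 0 → z₀ ∈ hX.ballFinset x D := fun x hx =>
          hX.mem_ballFinset.2 (hξ z₀ x hz₀ hx)
        refine ⟨Sum.elim (fun x => 1 - T * ξ x ^ 2) (fun e => T * (ξ e.1 * ξ e.2) - (1 - ε)),
          ⟨fun x z => if z = z₀ then T * ξ x ^ 2 else 0, ?_, ?_, ?_, ?_⟩, ?_⟩
        · intro x z
          beta_reduce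
          split_ifs
          · have := hξ0 x
            positivity
          · exact le_rfl
        · intro x z hxz
          beta_reduce
          split_ifs with hz
          · subst hz
            have : ξ x = 0 := by
              by_contra hx
              exact not_le.2 hxz (hξ z x hz₀ hx)
            simp [this]
          · rfl
        · intro x
          rw [Sum.elim_inl, Finset.sum_ite_eq']
          split_ifs
          · exact le_rfl
          · have := hξ0 x
            have : 0 ≤ T * ξ x ^ 2 := by positivity
            linarith
        · intro x y
          rw [Sum.elim_inr]
          by_cases hx : ξ x = 0
          · have h1 : (0 : ℝ) ≤ ∑ z ∈ hX.ballFinset x D, √((if z = z₀ then T * ξ x ^ 2 else 0)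
                * (if z = z₀ then T * ξ y ^ 2 else 0)) :=
              Finset.sum_nonneg fun z _ => Real.sqrt_nonneg _
            simp only [hx] at h1 ⊢
            linarith
          · have h1 := Finset.single_le_sum (f := fun z => √((if z = z₀ then T * ξ x ^ 2 else 0)
                * (if z = z₀ then T * ξ y ^ 2 else 0))) (fun z _ => Real.sqrt_nonneg _)
              (hball x hx)
            simp only [if_true] at h1
            have h2 : T * ξ x ^ 2 * (T * ξ y ^ 2) = (T * (ξ x * ξ y)) ^ 2 := by ring
            rw [h2, Real.sqrt_sq (mul_nonneg hT0 (mul_nonneg (hξ0 x) (hξ0 y)))] at h1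
            simp only
            linarith
        · rw [Finset.sum_disjSum]
          simp only [Sum.elim_inl, Sum.elim_inr]
          have h1 : ∑ x ∈ F, ω (Sum.inl x) * (1 - T * ξ x ^ 2)
              = ∑ x ∈ F, α x - T * ∑ x ∈ F, α x * ξ x ^ 2 := by
            rw [Finset.mul_sum, ← Finset.sum_sub_distrib]
            exact Finset.sum_congr rfl fun x _ => by ring
          have h2 : ∑ e ∈ E, ω (Sum.inr e) * (T * (ξ e.1 * ξ e.2) - (1 - ε))
              = T * ∑ e ∈ E, β e * (ξ e.1 * ξ e.2) - (1 - ε) * ∑ e ∈ E, β e := by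
            rw [Finset.mul_sum, Finset.mul_sum, ← Finset.sum_sub_distrib]
            exact Finset.sum_congr rfl fun x _ => by ring
          rw [h1, h2]
          have h3 : T * gap = |K| + 1 := div_mul_cancel₀ _ hgap0.ne'
          have h4 := neg_abs_le K
          have h5 : T * gap = T * ∑ e ∈ E, β e * (ξ e.1 * ξ e.2)
              - T * ∑ x ∈ F, α x * ξ x ^ 2 := by rw [hgap, mul_sub]
          linarith
      · push Not at hcase
        refine ⟨_, hzero, ?_⟩
        rw [Finset.sum_disjSum]
        simp only [Sum.elim_inl, Sum.elim_inr, mul_one]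
        rw [← Finset.sum_mul]
        -- extend the weights on pairs by zero, and symmetrise them, to get a matrix
        let γ : X → X → ℝ := fun x y => if (x, y) ∈ E then β (x, y) else 0
        have hγ0 : ∀ x y, 0 ≤ γ x y := fun x y => by
          simp only [γ]
          split_ifs
          · exact hω0 _
          · exact le_rfl
        have hγ : ∀ ξ : X → ℝ, ∑ x ∈ F, ∑ y ∈ F, γ x y * (ξ x * ξ y)
            = ∑ e ∈ E, β e * (ξ e.1 * ξ e.2) := by
          intro ξ
          rw [← Finset.sum_product', Finset.sum_filter]
          refine Finset.sum_congr rfl fun e he => ?_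
          simp only [γ, E, Finset.mem_filter, he, true_and, ite_mul, zero_mul]
        have hγ' : ∀ ξ : X → ℝ, ∑ x ∈ F, ∑ y ∈ F, (γ x y + γ y x) / 2 * (ξ x * ξ y)
            = ∑ e ∈ E, β e * (ξ e.1 * ξ e.2) := by
          intro ξ
          have h1 : ∑ x ∈ F, ∑ y ∈ F, γ y x * (ξ x * ξ y)
              = ∑ x ∈ F, ∑ y ∈ F, γ x y * (ξ x * ξ y) := by
            rw [Finset.sum_comm]
            exact Finset.sum_congr rfl fun x _ => Finset.sum_congr rfl fun y _ => by ring
          have h2 : ∑ x ∈ F, ∑ y ∈ F, (γ x y + γ y x) / 2 * (ξ x * ξ y)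
              = (∑ x ∈ F, ∑ y ∈ F, γ x y * (ξ x * ξ y)
                + ∑ x ∈ F, ∑ y ∈ F, γ y x * (ξ x * ξ y)) / 2 := by
            simp only [← Finset.sum_add_distrib, Finset.sum_div]
            exact Finset.sum_congr rfl fun x _ => Finset.sum_congr rfl fun y _ => by ring
          rw [h2, h1, hγ]
          ring
        have hmass := mul_sum_le_sum_of_nonneg (c := 1 - ε / 2) (by linarith) hR hS H F (α := α)
          (fun x => hω0 _) (A := fun x y => (γ x y + γ y x) / 2)
          (fun x y => by linarith [hγ0 x y, hγ0 y x]) (fun x y => by ring)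
          (fun x y hxy => by
            have h1 : (x, y) ∉ E := fun h => not_le.2 hxy ((hE x y).1 h).2.2
            have h2 : (y, x) ∉ E := fun h => not_le.2 hxy (dist_comm x y ▸ ((hE y x).1 h).2.2)
            simp [γ, h1, h2])
          (fun ξ hξ0 hξ => by
            rw [hγ']
            exact hcase ξ hξ0 hξ)
        have hβsum := hγ' (fun _ => 1)
        simp only [mul_one] at hβsum
        rw [hβsum] at hmass
        have hα0 : 0 ≤ ∑ x ∈ F, α x := Finset.sum_nonneg fun x _ => hω0 _
        have hβ0 : 0 ≤ ∑ e ∈ E, β e := Finset.sum_nonneg fun x _ => hω0 _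
        change 0 < ∑ x ∈ F, α x + (∑ e ∈ E, β e) * -(1 - ε)
        rcases hβ0.eq_or_lt with hβ0' | hβ0'
        · rw [← hβ0', zero_mul, add_zero]
          obtain ⟨j, hj, hjpos⟩ := hωpos
          rcases j with x | e
          · exact Finset.sum_pos' (fun x _ => hω0 _) ⟨x, by simpa using hj, hjpos⟩
          · have := (Finset.sum_eq_zero_iff_of_nonneg fun x _ => hω0 _).1 hβ0'.symm e
              (by simpa using hj)
            exact absurd this hjpos.ne'
        · nlinarith)
  refine ⟨w, hw0, hwD, fun x hx => ?_, fun x hx y hy hxy => ?_⟩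
  · have h1 := hpos (Sum.inl x) (by simpa using hx)
    linarith [hw1 x]
  · have h1 := hpos (Sum.inr (x, y)) (Finset.inr_mem_disjSum.2 ((hE x y).2 ⟨hx, hy, hxy⟩))
    linarith [hw2 x y]

/-! ### Kernels of probability vectors -/

/-- A kernel `ρ` on `X` whose rows `ρ x` are probability vectors supported in the balls
`B(x, D)`. -/
structure BoundedGeometry.IsProbabilityKernel {X : Type u} [MetricSpace X] (hX : BoundedGeometry X)
    (D : ℝ) (ρ : X → X → ℝ) : Prop where
  nonneg : ∀ x z, 0 ≤ ρ x z
  eq_zero : ∀ x z, D < dist z x → ρ x z = 0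
  sum_eq_one : ∀ x, ∑ z ∈ hX.ballFinset x D, ρ x z = 1

namespace BoundedGeometry.IsProbabilityKernel

variable {X : Type u} [MetricSpace X] {hX : BoundedGeometry X} {D : ℝ} {ρ : X → X → ℝ}

theorem eq_zero_of_notMem (hρ : hX.IsProbabilityKernel D ρ) {x z : X}
    (hz : z ∉ hX.ballFinset x D) : ρ x z = 0 :=
  hρ.eq_zero x z (not_le.1 fun h => hz (hX.mem_ballFinset.2 h))

theorem le_one (hρ : hX.IsProbabilityKernel D ρ) (x z : X) : ρ x z ≤ 1 := by
  by_cases hz : z ∈ hX.ballFinset x D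
  · rw [← hρ.sum_eq_one x]
    exact Finset.single_le_sum (fun z _ => hρ.nonneg x z) hz
  · rw [hρ.eq_zero_of_notMem hz]
    exact zero_le_one

/-- Taking `p`-th roots turns a slowly varying probability kernel into a metric partition of
unity, since `|a ^ (1 / p) - b ^ (1 / p)| ^ p ≤ |a - b|`. -/
theorem exists_isMetricPartitionOfUnity [DecidableEq X] (hρ : hX.IsProbabilityKernel D ρ)
    {p : ℝ} (hp : 1 ≤ p) {r ε ε' : ℝ} (hε : ε' < ε ^ p)
    (hvar : ∀ x y, dist x y ≤ r →
      ∑ z ∈ hX.ballFinset x D ∪ hX.ballFinset y D, |ρ x z - ρ y z| ≤ ε') :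
    ∃ φ : X → X → ℝ, IsMetricPartitionOfUnity p φ ∧ HasVariation p φ r ε := by
  have := hX.discreteTopology
  have hp0 : 0 < p := one_pos.trans_le hp
  have hsupp : ∀ z x, x ∈ tsupport (fun x => ρ x z ^ (1 / p)) → dist x z ≤ D := by
    intro z x hx
    rw [tsupport_eq_support_of_discrete] at hx
    by_contra hlt
    apply hx
    beta_reduce
    rw [hρ.eq_zero x z (by rw [dist_comm]; exact not_le.1 hlt), Real.zero_rpow (by positivity)]
  have hpow : ∀ x z, (ρ x z ^ (1 / p)) ^ p = ρ x z := fun x z => by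
    rw [← Real.rpow_mul (hρ.nonneg x z), one_div_mul_cancel hp0.ne', Real.rpow_one]
  refine ⟨fun z x => ρ x z ^ (1 / p), ⟨?_, ?_, ?_, ?_⟩, ?_⟩
  · exact fun z x => ⟨Real.rpow_nonneg (hρ.nonneg x z) _,
      Real.rpow_le_one (hρ.nonneg x z) (hρ.le_one x z) (by positivity)⟩
  · refine ⟨2 * D.toNNReal, fun z => Metric.ediam_le fun x hx y hy => ?_⟩
    rw [edist_nndist]
    have h1 := hsupp z x hx
    have h2 := hsupp z y hy
    have h3 := dist_triangle_right x y z
    rw [ENNReal.coe_le_coe, ← NNReal.coe_le_coe, coe_nndist]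
    push_cast
    linarith [Real.le_coe_toNNReal D]
  · obtain ⟨N, hN⟩ := hX D
    refine ⟨N, fun x => (Set.encard_le_encard fun z hz => ?_).trans (hN x)⟩
    rw [Metric.mem_closedBall, dist_comm]
    exact hsupp z x hz
  · intro x
    simp only [hpow]
    rw [← hρ.sum_eq_one x]
    exact hasSum_sum_of_ne_finset_zero fun z hz => hρ.eq_zero_of_notMem hz
  · intro x y hxy
    refine lt_of_le_of_lt ?_ hε
    rw [tsum_eq_sum (s := hX.ballFinset x D ∪ hX.ballFinset y D)]
    · refine (Finset.sum_le_sum fun z _ => ?_).trans (hvar x y hxy)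
      have key : ∀ a b : ℝ, 0 ≤ b → b ≤ a → |a ^ (1 / p) - b ^ (1 / p)| ^ p ≤ |a - b| := by
        intro a b hb hab
        have hroot : b ^ (1 / p) ≤ a ^ (1 / p) := Real.rpow_le_rpow hb hab (by positivity)
        rw [abs_of_nonneg (by linarith), abs_of_nonneg (by linarith)]
        have h1 := Real.rpow_add_le_add_rpow (p := 1 / p) hb (sub_nonneg.2 hab) (by positivity)
          ((div_le_one hp0).2 hp)
        rw [add_sub_cancel] at h1
        calc (a ^ (1 / p) - b ^ (1 / p)) ^ p ≤ ((a - b) ^ (1 / p)) ^ p :=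
              Real.rpow_le_rpow (by linarith) (by linarith) hp0.le
          _ = a - b := by
              rw [← Real.rpow_mul (by linarith), one_div_mul_cancel hp0.ne', Real.rpow_one]
      rcases le_total (ρ x z) (ρ y z) with h | h
      · rw [abs_sub_comm, abs_sub_comm (ρ x z)]
        exact key _ _ (hρ.nonneg x z) h
      · exact key _ _ (hρ.nonneg y z) h
    · intro z hz
      rw [Finset.mem_union, not_or] at hz
      beta_reduce
      rw [hρ.eq_zero_of_notMem hz.1, hρ.eq_zero_of_notMem hz.2, sub_self, abs_zero,
        Real.zero_rpow hp0.ne']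

/-- Slowly varying probability kernels exist on all of `X` if they exist with slow variation on
each finite subset: the kernels form a compact set. -/
theorem exists_of_forall_finset [DecidableEq X] {r ε : ℝ}
    (h : ∀ F : Finset X, ∃ ρ : X → X → ℝ, hX.IsProbabilityKernel D ρ ∧
      ∀ x ∈ F, ∀ y ∈ F, dist x y ≤ r →
        ∑ z ∈ hX.ballFinset x D ∪ hX.ballFinset y D, |ρ x z - ρ y z| ≤ ε) :
    ∃ ρ : X → X → ℝ, hX.IsProbabilityKernel D ρ ∧
      ∀ x y, dist x y ≤ r →
        ∑ z ∈ hX.ballFinset x D ∪ hX.ballFinset y D, |ρ x z - ρ y z| ≤ ε := by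
  let K : Finset X → Set (X → X → ℝ) := fun F => {ρ | hX.IsProbabilityKernel D ρ ∧
      ∀ x ∈ F, ∀ y ∈ F, dist x y ≤ r →
        ∑ z ∈ hX.ballFinset x D ∪ hX.ballFinset y D, |ρ x z - ρ y z| ≤ ε}
  have hclosed : ∀ F, IsClosed (K F) := by
    intro F
    have : K F = {ρ | ∀ x z, 0 ≤ ρ x z} ∩ {ρ | ∀ x z, D < dist z x → ρ x z = 0} ∩
        {ρ | ∀ x, ∑ z ∈ hX.ballFinset x D, ρ x z = 1} ∩
        {ρ | ∀ x ∈ F, ∀ y ∈ F, dist x y ≤ r →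
          ∑ z ∈ hX.ballFinset x D ∪ hX.ballFinset y D, |ρ x z - ρ y z| ≤ ε} := by
      ext ρ
      exact ⟨fun hρ => ⟨⟨⟨hρ.1.1, hρ.1.2⟩, hρ.1.3⟩, hρ.2⟩,
        fun hρ => ⟨⟨hρ.1.1.1, hρ.1.1.2, hρ.1.2⟩, hρ.2⟩⟩
    rw [this]
    simp only [Set.ofPred_forall]
    refine ((IsClosed.inter ?_ ?_).inter ?_).inter ?_
    · exact isClosed_iInter fun x => isClosed_iInter fun z =>
        isClosed_le (by fun_prop) (by fun_prop)
    · exact isClosed_iInter fun x => isClosed_iInter fun z => isClosed_iInter fun _ =>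
        isClosed_eq (by fun_prop) (by fun_prop)
    · exact isClosed_iInter fun x => isClosed_eq (by fun_prop) (by fun_prop)
    · exact isClosed_iInter fun x => isClosed_iInter fun _ => isClosed_iInter fun y =>
        isClosed_iInter fun _ => isClosed_iInter fun _ => isClosed_le (by fun_prop) (by fun_prop)
  have hcompact : ∀ F, IsCompact (K F) := fun F =>
    (isCompact_univ_pi fun _ : X => isCompact_univ_pi fun _ : X =>
      isCompact_Icc (a := (0 : ℝ)) (b := 1)).of_isClosed_subset (hclosed F)
      fun ρ hρ x _ z _ => ⟨hρ.1.nonneg x z, hρ.1.le_one x z⟩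
  have hdir : Directed (· ⊇ ·) K := by
    intro F G
    exact ⟨F ∪ G, fun ρ hρ => ⟨hρ.1, fun x hx y hy => hρ.2 x (Finset.mem_union_left _ hx) y
      (Finset.mem_union_left _ hy)⟩, fun ρ hρ => ⟨hρ.1, fun x hx y hy => hρ.2 x
      (Finset.mem_union_right _ hx) y (Finset.mem_union_right _ hy)⟩⟩
  obtain ⟨ρ, hρ⟩ := IsCompact.nonempty_iInter_of_directed_nonempty_isCompact_isClosed K hdir
    h hcompact hclosed
  rw [Set.mem_iInter] at hρ
  exact ⟨ρ, (hρ ∅).1, fun x y => (hρ {x, y}).2 x (by simp) y (by simp)⟩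

end BoundedGeometry.IsProbabilityKernel

theorem two_mul_abs_sub_le {δ a b : ℝ} (ha : 0 ≤ a) (hb : 0 ≤ b) :
    2 * δ * |a - b| ≤ 2 * δ ^ 2 * (a + b) + (a + b - 2 * √(a * b)) := by
  rw [Real.sqrt_mul ha]
  have h1 : |a - b| = |√a - √b| * (√a + √b) := by
    rw [← abs_of_nonneg (add_nonneg (Real.sqrt_nonneg a) (Real.sqrt_nonneg b)), ← abs_mul]
    congr 1
    nlinarith [Real.sq_sqrt ha, Real.sq_sqrt hb]
  rw [h1]
  have h2 : |√a - √b| ^ 2 = a + b - 2 * (√a * √b) := by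
    rw [sq_abs]
    nlinarith [Real.sq_sqrt ha, Real.sq_sqrt hb]
  have h3 : (√a + √b) ^ 2 ≤ 2 * (a + b) := by
    nlinarith [Real.sq_sqrt ha, Real.sq_sqrt hb, sq_nonneg (√a - √b)]
  nlinarith [sq_nonneg (|√a - √b| - δ * (√a + √b)),
    mul_le_mul_of_nonneg_left h3 (sq_nonneg δ)]

/-- The missing mass of a kernel with large affinities is put on the diagonal. -/
theorem exists_isProbabilityKernel_of_localisation {X : Type u} [MetricSpace X] [DecidableEq X]
    (hX : BoundedGeometry X) {δ R S : ℝ} (hδ : 0 < δ) (hδ1 : δ ≤ 1) (hR : 0 ≤ R) (hS : 0 ≤ S)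
    (H : ∀ a : Ell2 X →L[ℂ] Ell2 X, PropagationAtMost a R → ‖a‖ = 1 →
      ∃ v : Ell2 X, IsUnitSupportedIn v S ∧ 1 - δ ^ 2 / 2 ≤ ‖a v‖) (F : Finset X) :
    ∃ ρ : X → X → ℝ, hX.IsProbabilityKernel (S + 2 * R) ρ ∧
      ∀ x ∈ F, ∀ y ∈ F, dist x y ≤ R →
        ∑ z ∈ hX.ballFinset x (S + 2 * R) ∪ hX.ballFinset y (S + 2 * R), |ρ x z - ρ y z|
          ≤ 5 * δ := by
  obtain ⟨w, hw0, hwD, hw1, hwa⟩ := exists_kernel_of_localisation hX (ε := δ ^ 2) (by positivity)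
    (by nlinarith) hR hS H F
  set D := S + 2 * R with hD
  have hD0 : 0 ≤ D := by positivity
  have hwB : ∀ x z, z ∉ hX.ballFinset x D → w x z = 0 := fun x z hz =>
    hwD x z (not_le.1 fun h => hz (hX.mem_ballFinset.2 h))
  set M : X → ℝ := fun x => ∑ z ∈ hX.ballFinset x D, w x z with hM
  have hself : ∀ x, x ∈ hX.ballFinset x D := fun x => hX.mem_ballFinset.2 (by simpa using hD0)
  have hM1 : ∀ x ∈ F, 1 - δ ^ 2 ≤ M x := by
    intro x hx
    refine (hwa x hx x hx (by simpa using hR)).trans (le_of_eq (Finset.sum_congr rfl fun z _ => ?_))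
    exact Real.sqrt_mul_self (hw0 x z)
  refine ⟨fun x z => if x ∈ F then w x z + (if z = x then 1 - M x else 0)
    else if z = x then 1 else 0, ⟨fun x z => ?_, fun x z hxz => ?_, fun x => ?_⟩,
    fun x hx y hy hxy => ?_⟩
  · split_ifs with hx hz hz
    · exact add_nonneg (hw0 x z) (by linarith [hw1 x hx])
    · simpa using hw0 x z
    · exact zero_le_one
    · exact le_rfl
  · have hne : z ≠ x := by
      rintro rfl
      rw [dist_self] at hxz
      linarith
    simp [hne, hwD x z hxz]
  · by_cases hx : x ∈ F
    · simp only [hx, if_true, Finset.sum_add_distrib, Finset.sum_ite_eq', hself, hM]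
      ring
    · simp [hx, hself]
  · simp only [hx, hy, if_true]
    set U := hX.ballFinset x D ∪ hX.ballFinset y D with hU
    have hx_sum : ∑ z ∈ U, w x z = M x :=
      (Finset.sum_subset Finset.subset_union_left fun z _ hz => hwB x z hz).symm
    have hy_sum : ∑ z ∈ U, w y z = M y :=
      (Finset.sum_subset Finset.subset_union_right fun z _ hz => hwB y z hz).symm
    have hxU : x ∈ U := Finset.mem_union_left _ (hself x)
    have hyU : y ∈ U := Finset.mem_union_right _ (hself y)
    have haff : 1 - δ ^ 2 ≤ ∑ z ∈ U, √(w x z * w y z) :=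
      (hwa x hx y hy hxy).trans (Finset.sum_le_sum_of_subset_of_nonneg Finset.subset_union_left
        fun z _ _ => Real.sqrt_nonneg _)
    have hmain : ∑ z ∈ U, |w x z - w y z| ≤ 3 * δ := by
      have h1 : 2 * δ * ∑ z ∈ U, |w x z - w y z|
          ≤ 2 * δ ^ 2 * (M x + M y) + (M x + M y - 2 * ∑ z ∈ U, √(w x z * w y z)) := by
        rw [← hx_sum, ← hy_sum, ← Finset.sum_add_distrib, Finset.mul_sum, Finset.mul_sum,
          Finset.mul_sum, ← Finset.sum_sub_distrib, ← Finset.sum_add_distrib]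
        exact Finset.sum_le_sum fun z _ => two_mul_abs_sub_le (hw0 x z) (hw0 y z)
      nlinarith [hw1 x hx, hw1 y hy, mul_le_mul_of_nonneg_left (hw1 x hx) (sq_nonneg δ),
        mul_le_mul_of_nonneg_left (hw1 y hy) (sq_nonneg δ)]
    have hx0 : 0 ≤ 1 - M x := by linarith [hw1 x hx]
    have hy0 : 0 ≤ 1 - M y := by linarith [hw1 y hy]
    calc ∑ z ∈ U, |w x z + (if z = x then 1 - M x else 0)
          - (w y z + if z = y then 1 - M y else 0)|
        ≤ ∑ z ∈ U, (|w x z - w y z| + ((if z = x then 1 - M x else 0)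
          + if z = y then 1 - M y else 0)) := by
          refine Finset.sum_le_sum fun z _ => ?_
          have h1 : (0 : ℝ) ≤ if z = x then 1 - M x else 0 := by split_ifs <;> simp [hx0]
          have h2 : (0 : ℝ) ≤ if z = y then 1 - M y else 0 := by split_ifs <;> simp [hy0]
          rw [abs_le]
          constructor <;> linarith [neg_abs_le (w x z - w y z), le_abs_self (w x z - w y z)]
      _ = ∑ z ∈ U, |w x z - w y z| + ((1 - M x) + (1 - M y)) := by
          simp only [Finset.sum_add_distrib, Finset.sum_ite_eq', hxU, hyU, if_true]
      -- the defects are at most `δ ^ 2 ≤ δ` each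
      _ ≤ 5 * δ := by nlinarith [hM1 x hx, hM1 y hy]

theorem OperatorNormLocalisation.propertyA {X : Type u} [MetricSpace X] (hX : BoundedGeometry X)
    {p : ℝ} (hp : 1 ≤ p) (h : OperatorNormLocalisation X) : PropertyA p X := by
  classical
  intro r ε hr hε
  have hεp : 0 < ε ^ p := Real.rpow_pos_of_pos hε p
  obtain ⟨δ, hδ0, hδ1, hδε⟩ : ∃ δ : ℝ, 0 < δ ∧ δ ≤ 1 ∧ 5 * δ < ε ^ p := by
    refine ⟨min 1 (ε ^ p / 6), by positivity, min_le_left _ _, ?_⟩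
    have := min_le_right 1 (ε ^ p / 6)
    linarith
  obtain ⟨S, hS, H⟩ := h (1 - δ ^ 2 / 2) r (by nlinarith) (by nlinarith [pow_pos hδ0 2]) hr
  obtain ⟨ρ, hρ, hvar⟩ := BoundedGeometry.IsProbabilityKernel.exists_of_forall_finset
    (hX := hX) (exists_isProbabilityKernel_of_localisation hX hδ0 hδ1 hr.le hS.le H)
  obtain ⟨φ, hφ, hφr⟩ := hρ.exists_isMetricPartitionOfUnity hp hδε hvar
  exact ⟨X, φ, hφ, hφr⟩

/-! ### Property A implies sparsification -/

theorem abs_rpow_sub_rpow_le {p : ℝ} (hp : 1 ≤ p) {s : ℝ} (hs : 0 < s) (hs1 : s ≤ 1) {a b : ℝ}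
    (ha : 0 ≤ a) (hb : 0 ≤ b) :
    |a ^ p - b ^ p| ≤ p * s * (a ^ p + b ^ p) + (|a - b| / s) ^ p := by
  have hp0 : 0 < p := one_pos.trans_le hp
  have key : ∀ a b : ℝ, 0 ≤ b → b ≤ a →
      a ^ p - b ^ p ≤ p * s * (a ^ p + b ^ p) + ((a - b) / s) ^ p := by
    intro a b hb hba
    have ha := hb.trans hba
    have hap := Real.rpow_nonneg ha p
    have hbp := Real.rpow_nonneg hb p
    have hlast : 0 ≤ ((a - b) / s) ^ p :=
      Real.rpow_nonneg (div_nonneg (by linarith) hs.le) p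
    rcases le_or_gt (a - b) (s * a) with h | h
    · -- Bernoulli's inequality
      have h1 : (1 - p * s) * a ^ p ≤ b ^ p := by
        have hbern := one_add_mul_self_le_rpow_one_add (s := -s) (by linarith) hp
        calc (1 - p * s) * a ^ p ≤ (1 + -s) ^ p * a ^ p := by
              refine mul_le_mul_of_nonneg_right ?_ hap
              linarith
          _ = ((1 + -s) * a) ^ p := (Real.mul_rpow (by linarith) ha).symm
          _ ≤ b ^ p := Real.rpow_le_rpow (mul_nonneg (by linarith) ha) (by linarith) hp0.le
      have h2 : 0 ≤ p * s * b ^ p := by positivity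
      linarith
    · have h1 : a ^ p ≤ ((a - b) / s) ^ p := by
        refine Real.rpow_le_rpow ha ?_ hp0.le
        rw [le_div_iff₀ hs]
        linarith
      have h2 : 0 ≤ p * s * (a ^ p + b ^ p) := by positivity
      linarith
  rcases le_total b a with h | h
  · rw [abs_of_nonneg (sub_nonneg.2 (Real.rpow_le_rpow hb h hp0.le)),
      abs_of_nonneg (sub_nonneg.2 h)]
    exact key a b hb h
  · rw [abs_sub_comm, abs_sub_comm a, add_comm (a ^ p),
      abs_of_nonneg (sub_nonneg.2 (Real.rpow_le_rpow ha h hp0.le)),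
      abs_of_nonneg (sub_nonneg.2 h)]
    exact key b a ha h

/-- The case `p = 1` of Property A follows from any other. -/
theorem PropertyA.exists_partition {X : Type u} [MetricSpace X] {p : ℝ} (hp : 1 ≤ p)
    (h : PropertyA p X) {r δ : ℝ} (hr : 0 < r) (hδ : 0 < δ) :
    ∃ (ι : Type u) (ξ : X → ι → ℝ) (D : ℝ≥0), (∀ x i, 0 ≤ ξ x i) ∧
      (∀ x, {i | ξ x i ≠ 0}.Finite) ∧ (∀ x, HasSum (ξ x) 1) ∧
      (∀ i, Metric.ediam {x | ξ x i ≠ 0} ≤ D) ∧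
      ∀ x y, dist x y ≤ r → ∀ I : Finset ι, ∑ i ∈ I, |ξ x i - ξ y i| ≤ δ := by
  have hp0 : 0 < p := one_pos.trans_le hp
  obtain ⟨s, hs0, hs1, hsδ⟩ : ∃ s : ℝ, 0 < s ∧ s ≤ 1 ∧ p * s ≤ δ / 4 := by
    refine ⟨min 1 (δ / 4 / p), by positivity, min_le_left _ _, ?_⟩
    calc p * min 1 (δ / 4 / p) ≤ p * (δ / 4 / p) := by gcongr; exact min_le_right _ _
      _ = δ / 4 := by field_simp
  obtain ⟨ι, φ, hφ, hvar⟩ := h r (s * (δ / 2) ^ (1 / p)) hr (by positivity)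
  obtain ⟨D, hD⟩ := hφ.uniformly_bounded
  obtain ⟨M, hM⟩ := hφ.finite_multiplicity
  have h0 : ∀ i x, 0 ≤ φ i x := fun i x => (hφ.mem_unitInterval i x).1
  have hfin : ∀ x, {i | φ i x ≠ 0}.Finite := fun x =>
    (Set.finite_of_encard_le_coe (hM x)).subset fun i hi => subset_tsupport _ hi
  have hne : ∀ x i, φ i x ^ p ≠ 0 → φ i x ≠ 0 := fun x i hi h => hi (by
    rw [h, Real.zero_rpow hp0.ne'])
  refine ⟨ι, fun x i => φ i x ^ p, D, fun x i => Real.rpow_nonneg (h0 i x) p,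
    fun x => (hfin x).subset fun i => hne x i, hφ.hasSum_one,
    fun i => (Metric.ediam_mono fun x hx => subset_tsupport _ (hne x i hx)).trans (hD i),
    fun x y hxy I => ?_⟩
  have hsummable : Summable fun i => |φ i x - φ i y| ^ p := by
    refine summable_of_hasFiniteSupport (((hfin x).union (hfin y)).subset fun i hi => ?_)
    by_contra hcon
    rw [Set.mem_union, not_or] at hcon
    simp only [Set.mem_ofPred_eq, not_not] at hcon
    exact hi (by simp [hcon.1, hcon.2, Real.zero_rpow hp0.ne'])
  have hle1 : ∀ z, ∑ i ∈ I, φ i z ^ p ≤ 1 := fun z =>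
    sum_le_hasSum I (fun i _ => Real.rpow_nonneg (h0 i z) p) (hφ.hasSum_one z)
  have hsp : 0 < s ^ p := Real.rpow_pos_of_pos hs0 p
  have hle2 : ∑ i ∈ I, (|φ i x - φ i y| / s) ^ p ≤ δ / 2 := by
    calc ∑ i ∈ I, (|φ i x - φ i y| / s) ^ p = (∑ i ∈ I, |φ i x - φ i y| ^ p) / s ^ p := by
          rw [Finset.sum_div]
          exact Finset.sum_congr rfl fun i _ => Real.div_rpow (abs_nonneg _) hs0.le _
      _ ≤ (s * (δ / 2) ^ (1 / p)) ^ p / s ^ p := by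
          gcongr
          exact (hsummable.sum_le_tsum I fun i _ => Real.rpow_nonneg (abs_nonneg _) p).trans
            (hvar x y hxy).le
      _ = δ / 2 := by
          rw [Real.mul_rpow hs0.le (by positivity), ← Real.rpow_mul (by positivity),
            one_div_mul_cancel hp0.ne', Real.rpow_one, mul_div_cancel_left₀ _ hsp.ne']
  calc ∑ i ∈ I, |φ i x ^ p - φ i y ^ p|
      ≤ ∑ i ∈ I, (p * s * (φ i x ^ p + φ i y ^ p) + (|φ i x - φ i y| / s) ^ p) :=
        Finset.sum_le_sum fun i _ => abs_rpow_sub_rpow_le hp hs0 hs1 (h0 i x) (h0 i y)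
    _ = p * s * (∑ i ∈ I, φ i x ^ p + ∑ i ∈ I, φ i y ^ p)
        + ∑ i ∈ I, (|φ i x - φ i y| / s) ^ p := by
        rw [Finset.sum_add_distrib, ← Finset.mul_sum, Finset.sum_add_distrib]
    _ ≤ δ / 4 * (1 + 1) + δ / 2 := by
        refine add_le_add (mul_le_mul hsδ (add_le_add (hle1 x) (hle1 y)) ?_ (by positivity)) hle2
        exact add_nonneg (Finset.sum_nonneg fun i _ => Real.rpow_nonneg (h0 i x) p)
          (Finset.sum_nonneg fun i _ => Real.rpow_nonneg (h0 i y) p)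
    _ = δ := by ring

/-- Integration of an inequality between step functions. -/
theorem sum_mul_le_sum_mul_of_step {J K : Type*} (s : Finset J) (s' : Finset K) (a l u : J → ℝ)
    (b l' u' : K → ℝ)
    (h : ∀ t : ℝ, ∑ j ∈ s, (Set.Ico (l j) (u j)).indicator (fun _ => a j) t
      ≤ ∑ k ∈ s', (Set.Ico (l' k) (u' k)).indicator (fun _ => b k) t) :
    ∑ j ∈ s, max (u j - l j) 0 * a j ≤ ∑ k ∈ s', max (u' k - l' k) 0 * b k := by
  have hint : ∀ l u a : ℝ, Integrable ((Set.Ico l u).indicator fun _ => a) := fun l u a =>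
    (integrable_indicator_iff measurableSet_Ico).2 (integrableOn_const (by simp))
  have hval : ∀ l u a : ℝ, ∫ t, (Set.Ico l u).indicator (fun _ => a) t = max (u - l) 0 * a := by
    intro l u a
    rw [integral_indicator_const _ measurableSet_Ico, Real.volume_real_Ico, smul_eq_mul]
  have := integral_mono (integrable_finsetSum s fun j _ => hint (l j) (u j) (a j))
    (integrable_finsetSum s' fun k _ => hint (l' k) (u' k) (b k)) h
  rw [integral_finsetSum _ fun j _ => hint _ _ _, integral_finsetSum _ fun k _ => hint _ _ _] at this
  simpa only [hval] using this

/-- Among the level sets of a slowly varying partition there is one whose boundary has small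
measure relative to its own. -/
theorem exists_level_set_of_partition {X ι : Type*} [MetricSpace X] [DecidableEq X]
    (hX : BoundedGeometry X) {ξ : X → ι → ℝ} {D : ℝ≥0∞} {r δ κ : ℝ} {N : ℕ}
    (hξ0 : ∀ x i, 0 ≤ ξ x i) (hfin : ∀ x, {i | ξ x i ≠ 0}.Finite) (hsum : ∀ x, HasSum (ξ x) 1)
    (hD : ∀ i, Metric.ediam {x | ξ x i ≠ 0} ≤ D)
    (hvar : ∀ x y, dist x y ≤ r → ∀ I : Finset ι, ∑ i ∈ I, |ξ x i - ξ y i| ≤ δ)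
    (hN : ∀ x, (hX.ballFinset x r).card ≤ N) (hδ : 0 ≤ δ) (hκ : N * δ < κ) (F : Finset X)
    {μ : X → ℝ} (hμ : ∀ x, 0 ≤ μ x) (hμF : 0 < ∑ x ∈ F, μ x) :
    ∃ E ⊆ F, E.Nonempty ∧ Metric.ediam (E : Set X) ≤ D ∧
      ∑ y ∈ F with y ∉ E ∧ ∃ x ∈ E, dist x y ≤ r, μ y ≤ κ * ∑ x ∈ E, μ x := by
  classical
  by_contra hcon
  push Not at hcon
  set K : Finset (X × X) := {e ∈ F ×ˢ F | dist e.1 e.2 ≤ r} with hK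
  -- for each member of the partition, compare the areas under the measures of the level sets and
  -- of their boundaries
  have hi : ∀ i, ∑ x ∈ F, max (ξ x i - 0) 0 * (κ * μ x)
      ≤ ∑ e ∈ K, max (ξ e.2 i - ξ e.1 i) 0 * μ e.1 := by
    intro i
    refine sum_mul_le_sum_mul_of_step F K (fun x => κ * μ x) (fun _ => 0) (fun x => ξ x i)
      (fun e => μ e.1) (fun e => ξ e.1 i) (fun e => ξ e.2 i) fun t => ?_
    have hterm : ∀ e : X × X, 0 ≤ (Set.Ico (ξ e.1 i) (ξ e.2 i)).indicator (fun _ => μ e.1) t :=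
      fun e => Set.indicator_nonneg (fun _ _ => hμ _) _
    set E : Finset X := {x ∈ F | t ∈ Set.Ico 0 (ξ x i)} with hE
    have hleft : ∑ x ∈ F, (Set.Ico 0 (ξ x i)).indicator (fun _ => κ * μ x) t
        = κ * ∑ x ∈ E, μ x := by
      rw [Finset.mul_sum, hE, Finset.sum_filter]
      exact Finset.sum_congr rfl fun x _ => Set.indicator_apply _ _ _
    rw [hleft]
    rcases E.eq_empty_or_nonempty with h | h
    · rw [h, Finset.sum_empty, mul_zero]
      exact Finset.sum_nonneg fun e _ => hterm e
    have ht0 : 0 ≤ t := by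
      obtain ⟨x, hx⟩ := h
      exact (Finset.mem_filter.1 hx).2.1
    refine (hcon E (Finset.filter_subset _ _) h ((Metric.ediam_mono fun x hx => ?_).trans
      (hD i))).le.trans ?_
    · exact (ht0.trans_lt (Finset.mem_filter.1 hx).2.2).ne'
    rw [Finset.sum_filter, hK, Finset.sum_filter, Finset.sum_product]
    refine Finset.sum_le_sum fun y hy => ?_
    have hnn : ∀ x ∈ F, 0 ≤ if dist y x ≤ r then
        (Set.Ico (ξ y i) (ξ x i)).indicator (fun _ => μ y) t else 0 := fun x _ => by
      split_ifs
      · exact hterm (y, x)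
      · exact le_rfl
    split_ifs with hyE
    · obtain ⟨hyE, x, hxE, hxy⟩ := hyE
      have hxF := Finset.mem_filter.1 hxE
      refine le_trans (le_of_eq ?_) (Finset.single_le_sum hnn hxF.1)
      rw [if_pos (by rwa [dist_comm]), Set.indicator_of_mem]
      refine ⟨?_, hxF.2.2⟩
      by_contra hlt
      exact hyE (Finset.mem_filter.2 ⟨hy, ht0, not_le.1 hlt⟩)
    · exact Finset.sum_nonneg hnn
  let I : Finset ι := F.biUnion fun x => (hfin x).toFinset
  have hI : ∀ x ∈ F, ∑ i ∈ I, ξ x i = 1 := by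
    intro x hx
    refine (hasSum_sum_of_ne_finset_zero fun i hiI => ?_).unique (hsum x)
    by_contra hne
    exact hiI (Finset.mem_biUnion.2 ⟨x, hx, (hfin x).mem_toFinset.2 hne⟩)
  have htotal := Finset.sum_le_sum fun i (_ : i ∈ I) => hi i
  rw [Finset.sum_comm, Finset.sum_comm (s := I)] at htotal
  have hl : ∑ x ∈ F, ∑ i ∈ I, max (ξ x i - 0) 0 * (κ * μ x) = κ * ∑ x ∈ F, μ x := by
    rw [Finset.mul_sum]
    refine Finset.sum_congr rfl fun x hx => ?_
    rw [← Finset.sum_mul]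
    have : ∑ i ∈ I, max (ξ x i - 0) 0 = 1 := by
      rw [← hI x hx]
      exact Finset.sum_congr rfl fun i _ => by rw [sub_zero, max_eq_left (hξ0 x i)]
    rw [this, one_mul]
  have hrt : ∑ e ∈ K, ∑ i ∈ I, max (ξ e.2 i - ξ e.1 i) 0 * μ e.1
      ≤ N * δ * ∑ x ∈ F, μ x := by
    calc ∑ e ∈ K, ∑ i ∈ I, max (ξ e.2 i - ξ e.1 i) 0 * μ e.1
        ≤ ∑ e ∈ K, δ * μ e.1 := by
          refine Finset.sum_le_sum fun e he => ?_
          rw [← Finset.sum_mul]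
          refine mul_le_mul_of_nonneg_right ?_ (hμ _)
          refine le_trans (Finset.sum_le_sum fun i _ => ?_)
            (hvar e.2 e.1 (by rw [dist_comm]; exact (Finset.mem_filter.1 he).2) I)
          exact max_le (le_abs_self _) (abs_nonneg _)
      _ = ∑ y ∈ F, ∑ x ∈ F with dist y x ≤ r, δ * μ y := by
          rw [hK, Finset.sum_filter, Finset.sum_product]
          exact Finset.sum_congr rfl fun y _ => (Finset.sum_filter _ _).symm
      _ ≤ ∑ y ∈ F, N * (δ * μ y) := by
          refine Finset.sum_le_sum fun y _ => ?_
          rw [Finset.sum_const, nsmul_eq_mul]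
          refine mul_le_mul_of_nonneg_right ?_ (mul_nonneg hδ (hμ y))
          refine Nat.cast_le.2 ((Finset.card_le_card fun x hx => ?_).trans (hN y))
          rw [BoundedGeometry.mem_ballFinset, dist_comm]
          exact (Finset.mem_filter.1 hx).2
      _ = N * δ * ∑ x ∈ F, μ x := by
          rw [Finset.mul_sum]
          exact Finset.sum_congr rfl fun y _ => by ring
  rw [hl] at htotal
  have := mul_lt_mul_of_pos_right hκ hμF
  linarith

/-- If every finite set of positive mass contains a set of small diameter and small
relative boundary, then cutting out such sets one after the other, and discarding their boundaries,
uses up any finite set, and only a small proportion of the mass is discarded. -/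
theorem exists_separated_of_small_boundary {X : Type*} [MetricSpace X] [DecidableEq X]
    {D : ℝ≥0∞} {r κ : ℝ} {μ : X → ℝ}
    (H : ∀ F : Finset X, 0 < ∑ x ∈ F, μ x → ∃ E ⊆ F, E.Nonempty ∧ Metric.ediam (E : Set X) ≤ D ∧
      ∑ y ∈ F with y ∉ E ∧ ∃ x ∈ E, dist x y ≤ r, μ y ≤ κ * ∑ x ∈ E, μ x)
    (F : Finset X) :
    ∃ P : Finset (Finset X), (∀ E ∈ P, E ⊆ F) ∧ (∀ E ∈ P, Metric.ediam (E : Set X) ≤ D) ∧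
      (∀ E ∈ P, ∀ E' ∈ P, E ≠ E' → Disjoint E E' ∧ ∀ x ∈ E, ∀ y ∈ E', r < dist x y) ∧
      ∑ x ∈ F, μ x ≤ (1 + κ) * ∑ x ∈ P.biUnion id, μ x := by
  classical
  induction F using Finset.strongInduction with
  | H F ih =>
    rcases le_or_gt (∑ x ∈ F, μ x) 0 with h0 | h0
    · exact ⟨∅, by simp, by simp, by simp, by simpa using h0⟩
    obtain ⟨E, hEF, hEne, hED, hE⟩ := H F h0
    set B : Finset X := {y ∈ F | y ∉ E ∧ ∃ x ∈ E, dist x y ≤ r} with hB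
    set F' := F \ (E ∪ B) with hF'
    have hEB : E ∪ B ⊆ F := Finset.union_subset hEF (Finset.filter_subset _ _)
    have hdEB : Disjoint E B := Finset.disjoint_left.2 fun x hx hxB =>
      (Finset.mem_filter.1 hxB).2.1 hx
    obtain ⟨P, hPF, hPD, hPsep, hPμ⟩ := ih F' (by
      refine Finset.sdiff_ssubset hEB ?_
      exact hEne.mono Finset.subset_union_left)
    have hfar : ∀ E' ∈ P, Disjoint E E' ∧ ∀ x ∈ E, ∀ y ∈ E', r < dist x y := by
      intro E' hE'
      have hd : Disjoint E E' := Finset.disjoint_left.2 fun x hx hx' =>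
        (Finset.mem_sdiff.1 (hPF E' hE' hx')).2 (Finset.mem_union_left _ hx)
      refine ⟨hd, fun x hx y hy => ?_⟩
      by_contra hle
      have hy' := Finset.mem_sdiff.1 (hPF E' hE' hy)
      exact hy'.2 (Finset.mem_union_right _ (Finset.mem_filter.2
        ⟨hy'.1, fun hyE => Finset.disjoint_left.1 hd hyE hy, x, hx, not_lt.1 hle⟩))
    refine ⟨insert E P, ?_, ?_, ?_, ?_⟩
    · intro E' hE'
      rcases Finset.mem_insert.1 hE' with rfl | h
      · exact hEF
      · exact (hPF E' h).trans Finset.sdiff_subset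
    · intro E' hE'
      rcases Finset.mem_insert.1 hE' with rfl | h
      · exact hED
      · exact hPD E' h
    · intro E₁ h₁ E₂ h₂ hne
      rcases Finset.mem_insert.1 h₁ with rfl | h₁' <;> rcases Finset.mem_insert.1 h₂ with rfl | h₂'
      · exact absurd rfl hne
      · exact hfar E₂ h₂'
      · refine ⟨(hfar E₁ h₁').1.symm, fun x hx y hy => ?_⟩
        rw [dist_comm]
        exact (hfar E₁ h₁').2 y hy x hx
      · exact hPsep E₁ h₁' E₂ h₂' hne
    · rw [Finset.biUnion_insert, id, Finset.sum_union (by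
        rw [Finset.disjoint_biUnion_right]
        exact fun E' hE' => (hfar E' hE').1), ← Finset.sum_sdiff hEB, Finset.sum_union hdEB]
      linarith

/-- In a nonempty space of bounded geometry, a finite measure is concentrated on a finite set up to
a small proportion. -/
theorem BoundedGeometry.exists_finset_mul_measure_le {X : Type u} [MetricSpace X] [Nonempty X]
    [MeasurableSpace X] (hX : BoundedGeometry X) (μ : Measure X)
    [IsFiniteMeasure μ] {c : ℝ} (hc : c < 1) :
    ∃ F : Finset X, c * μ.real Set.univ ≤ μ.real (F : Set X) := by
  obtain ⟨x₀⟩ := ‹Nonempty X›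
  rcases measureReal_nonneg (μ := μ) (s := Set.univ) |>.eq_or_lt with h0 | h0
  · exact ⟨∅, by rw [← h0]; simp⟩
  have hmono : Monotone fun n : ℕ => Metric.closedBall x₀ (n : ℝ) := fun m n hmn =>
    Metric.closedBall_subset_closedBall (by exact_mod_cast hmn)
  have htend := tendsto_measure_iUnion_atTop (μ := μ) hmono
  rw [Metric.iUnion_closedBall_nat] at htend
  have htend' := (ENNReal.tendsto_toReal (measure_ne_top μ Set.univ)).comp htend
  obtain ⟨n, hn⟩ := (htend'.eventually (lt_mem_nhds (show c * μ.real Set.univ < μ.real Set.univ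
    from mul_lt_of_lt_one_left h0 hc))).exists
  refine ⟨hX.ballFinset x₀ n, hn.le.trans (le_of_eq ?_)⟩
  rw [BoundedGeometry.ballFinset, Set.Finite.coe_toFinset]
  rfl

theorem PropertyA.metricSparsification {X : Type u} [MetricSpace X] [Nonempty X]
    [MeasurableSpace X] [BorelSpace X] (hX : BoundedGeometry X) {p : ℝ} (hp : 1 ≤ p)
    (h : PropertyA p X) : MetricSparsification X := by
  classical
  have := hX.discreteTopology
  have : DiscreteMeasurableSpace X := ⟨fun s => (isOpen_discrete s).measurableSet⟩
  intro c hc0 hc1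
  -- a proportion `c'` of the mass sits on a finite set, of which a proportion `1 / (1 + κ)` is kept
  set c' := (1 + c) / 2 with hc'
  set κ := c' / c - 1 with hκ
  have hκ0 : 0 < κ := by
    rw [hκ, sub_pos, one_lt_div hc0]
    linarith
  have hκc : c * (1 + κ) = c' := by
    rw [hκ]
    field_simp
    ring
  have hscale : ∀ m : ℕ, ∃ D : ℕ, ∀ μ : X → ℝ, (∀ x, 0 ≤ μ x) → ∀ F : Finset X,
      0 < ∑ x ∈ F, μ x → ∃ E ⊆ F, E.Nonempty ∧ Metric.ediam (E : Set X) ≤ (D : ℝ≥0∞) ∧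
        ∑ y ∈ F with y ∉ E ∧ ∃ x ∈ E, dist x y ≤ (m + 1 : ℝ), μ y ≤ κ * ∑ x ∈ E, μ x := by
    intro m
    obtain ⟨N, hN⟩ := hX.exists_card_ballFinset_le (m + 1)
    have hδ : 0 < κ / (N + 1) := by positivity
    obtain ⟨ι, ξ, D, hξ0, hfin, hsum, hD, hvar⟩ :=
      h.exists_partition hp (r := m + 1) (by positivity) hδ
    refine ⟨⌈D⌉₊, fun μ hμ F hF => exists_level_set_of_partition hX hξ0 hfin hsum
      (fun i => (hD i).trans ?_) hvar hN hδ.le ?_ F hμ hF⟩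
    · exact_mod_cast Nat.le_ceil D
    · rw [mul_div_assoc', div_lt_iff₀ (by positivity)]
      linarith
  choose D hD using hscale
  -- summing over all smaller scales makes the bound monotone
  refine ⟨fun m => ∑ k ∈ Finset.range (m + 1), D k, fun m n hmn =>
    Finset.sum_le_sum_of_subset (Finset.range_mono (by lia)), fun m μ _ => ?_⟩
  obtain ⟨F, hF⟩ := hX.exists_finset_mul_measure_le μ (c := c') (by rw [hc']; linarith)
  obtain ⟨P, -, hPD, hPsep, hPμ⟩ := exists_separated_of_small_boundary
    (hD m (fun x => μ.real {x}) fun x => measureReal_nonneg) F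
  refine ⟨P, fun E => (E : Set X), MeasurableSet.of_discrete, fun E E' hne => ?_,
    fun E E' hne => ?_, fun E => ?_, ?_⟩
  · exact Finset.disjoint_coe.2 (hPsep E E.2 E' E'.2 (Subtype.coe_injective.ne hne)).1
  · refine le_iInf₂ fun x hx => le_iInf₂ fun y hy => ?_
    have := (hPsep E E.2 E' E'.2 (Subtype.coe_injective.ne hne)).2 x hx y hy
    rw [edist_dist, ← ENNReal.ofReal_natCast]
    exact ENNReal.ofReal_le_ofReal (by linarith)
  · refine (hPD E E.2).trans ?_
    exact_mod_cast Finset.single_le_sum (f := D) (fun _ _ => Nat.zero_le _)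
      (Finset.mem_range.2 (Nat.lt_succ_self m))
  · have hU : (⋃ E : P, ((E : Finset X) : Set X)) = ((P.biUnion id : Finset X) : Set X) := by
      ext x
      simp
    rw [hU, ← sum_measureReal_singleton (μ := μ)]
    rw [← sum_measureReal_singleton (μ := μ), ← hκc] at hF
    have h1 : 0 < 1 + κ := by linarith
    have h2 : (1 + κ) * (c * μ.real Set.univ) ≤ (1 + κ) * ∑ x ∈ P.biUnion id, μ.real {x} := by
      linarith
    exact le_of_mul_le_mul_left h2 h1

/-! ### The equivalence -/

theorem proposition5p3 {X : Type u} [MetricSpace X] [Nonempty X] [MeasurableSpace X] [BorelSpace X]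
    (hX : BoundedGeometry X) (p : ℝ) (hp : 1 ≤ p) :
    List.TFAE
      [PropertyA p X,
       MetricSparsification X,
       CommutantLocalisationEps X,
       CommutantLocalisationC X,
       OperatorNormLocalisation X] := by
  tfae_have 1 → 2 := fun h => h.metricSparsification hX hp
  tfae_have 2 → 3 := commutantLocalisationEps_of_metricSparsification hX
  tfae_have 3 → 4 := fun h => h.commutantLocalisationC
  tfae_have 4 → 5 := fun h => h.operatorNormLocalisation hX
  tfae_have 5 → 1 := fun h => h.propertyA hX hp
  tfae_finish
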